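/- **Setting.** Messages are built from variables $x$, located aliases $s\lambda$ ($s\in\{0,1\}^*$ a location prefix, $\lambda$ an alias variable; $\lambda$ alone means $\epsilon\lambda$) and the symbols $\langle\cdot,\cdot\rangle,\mathrm{fst},\mathrm{snd},\mathrm{enc}(\cdot,\cdot),\mathrm{dec}(\cdot,\cdot),\mathrm{mac}(\cdot,\cdot)$. The relation $=_E$ is the congruence generated by $\mathrm{fst}\langle M,N\rangle=M$, $\mathrm{snd}\langle M,N\rangle=N$, $\mathrm{dec}(\mathrm{enc}(M,K),K)=M$. Processes are $0$, $\nu x.P$, $P|Q$, $!P$, $[M=N]P$ and guarded processes $G,H::=M(x).P\mid\overline M\langle N\rangle.P\mid[M=N]G\mid G+H\mid\nu x.G$. Extended processes are $\nu\vec x.(\sigma|P)$ with $\sigma$ an active substitution, i.e. a finite map from aliases to alias-free messages, and $P$ alias-free. A process $P$ is identified with $\mathrm{id}|P$. Terms are taken up to $\alpha$-conversion and bound names are chosen fresh. **Transitions** carry an action $\pi$ (an input $M\,N$, an output $\overline M(\alpha)$, or $\tau$) and a location label $u$, which is a location $s[t]$ or a pair of locations. For processes: - if $M=_EK$ then $K(x).P\xrightarrow[{[]}]{M\,N}\mathrm{id}|P\{N/x\}$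 and $\overline K\langle N\rangle.P\xrightarrow[{[]}]{\overline M(\lambda)}\{N/\lambda\}|P$; - if $P\xrightarrow[u]{\pi}\nu\vec x.(\sigma|R)$ then $P|Q\xrightarrow[0u]{\pi}\nu\vec x.(\sigma|R|Q)$ and $Q|P\xrightarrow[1u]{\pi}\nu\vec x.(\sigma|Q|R)$; - if $P\xrightarrow[u]{\pi}A$ then $\nu x.P\xrightarrow[u]{\pi}\nu x.A$ when $x$ does not occur in $\pi$, and $[M=N]P\xrightarrow[u]{\pi}A$ when $M=_EN$; - $!P$ has the transitions of $P|\,!P$; $G+H$ has those of $G$ and of $H$ with location $[t]$ replaced by $[0t]$ and $[1t]$ respectively; - if $P\xrightarrow[\ell_0]{\overline M(\lambda)}\nu\vec y.(\{N/\lambda\}|P')$ and $Q\xrightarrow[\ell_1]{M\,N}\nu\vec w.(\mathrm{id}|Q')$ then $P|Q\xrightarrow[(0\ell_0,1\ell_1)]{\tau}\nu\vec y,\vec w.(\mathrm{id}|P'|Q')$, and symmetrically. For extended processes: $A\xrightarrow[u]{\pi}B$ gives $\nu x.A\xrightarrow[u]{\pi}\nu x.B$ if $x$ does not occur in $\pi$.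 If $P\xrightarrow[s[t]]{\overline{M\sigma}(\lambda)}\nu\vec x.(\{N/\lambda\}|Q)$, the aliases of $M$ are in $\mathrm{dom}\,\sigma$ and $s\lambda\notin\mathrm{dom}\,\sigma$, then $\sigma|P\xrightarrow[s[t]]{\overline M(s\lambda)}\nu\vec x.(\sigma\circ\{N/s\lambda\}|Q)$. If $\pi$ is not an output, its aliases are in $\mathrm{dom}\,\sigma$ and $P\xrightarrow[u]{\pi\sigma}\nu\vec x.(\mathrm{id}|Q)$, then $\sigma|P\xrightarrow[u]{\pi}\nu\vec x.(\sigma|Q)$. **Similarity.** Write $\mathrm{dom}(\nu\vec x.(\sigma|P))=\mathrm{dom}\,\sigma$, and $\nu\vec x.(\sigma|P)\vDash M=N$ iff $M\sigma=_EN\sigma$ (with $\vec x$ fresh for $M,N$). An $i$-simulation is a relation $\mathcal R$ indexed by bijections $\rho:\mathrm{dom}A\to\mathrm{dom}B$ such that $A\,\mathcal R^\rho B$ implies: (i) if $A\xrightarrow[u]{\pi}A'$ with $\pi$ not an output, then $B\xrightarrow[u']{\pi\rho}B'$ and $A'\mathcal R^\rho B'$ for some $B',u'$; (ii) if $A\xrightarrow[u]{\overline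 M(\alpha)}A'$, then $B\xrightarrow[u']{\overline{M\rho}(\alpha')}B'$ and $A'\mathcal R^{\rho[\alpha\mapsto\alpha']}B'$ for some $B',u',\alpha'$; (iii) for all $M,N$ with aliases in $\mathrm{dom}A$, $A\vDash M=N$ iff $B\vDash M\rho=N\rho$. $A$ is $i$-simulated by $B$ if $A\,\mathcal R^{\mathrm{id}}B$ for some $i$-simulation $\mathcal R$. **Logic.** Formulas of $\mathcal{FM}$ are $\mathtt{true}$, $M=N$, $\phi\wedge\psi$, $\neg\phi$, $\langle\tau\rangle\phi$, $\langle M\,N\rangle\phi$, $\langle\overline M(x)\rangle\phi$ (binding $x$ in $\phi$). Satisfaction is as usual, with $A\vDash\langle\pi\rangle\phi$ iff $A\xrightarrow[u]{\pi}B$ and $B\vDash\phi$ for some $u,B$ (for $\pi$ not an output), and $A\vDash\langle\overline M(x)\rangle\phi$ iff $A\xrightarrow[u]{\overline M(\alpha)}B$ and $B\vDash\phi\{\alpha/x\}$ for some $u,B$ and some alias $\alpha$ not in $\phi$. The simulation fragment consists of the formulas in which negation is applied to equalities only. **The protocol (BAC).** Let $c,d,g$ be distinct variables ($g$ is the constant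 $\mathit{getChallenge}$, known to the attacker as a free variable), and let $$P(ke,km)=\nu nt.\overline c\langle nt\rangle.d(y).[\mathrm{snd}(y)=\mathrm{mac}(\mathrm{fst}(y),km)][nt=\mathrm{fst}(\mathrm{snd}(\mathrm{dec}(\mathrm{fst}(y),ke)))]\,\nu kt.\overline c\langle\langle m,\mathrm{mac}(m,km)\rangle\rangle.0$$ with $m=\mathrm{enc}(\langle nt,\langle\mathrm{fst}(\mathrm{dec}(\mathrm{fst}(y),ke)),kt\rangle\rangle,ke)$, $$V(ke,km)=d(nt).\nu nr.\nu kr.\overline c\langle\langle m',\mathrm{mac}(m',km)\rangle\rangle.0,\qquad m'=\mathrm{enc}(\langle nr,\langle nt,kr\rangle\rangle,ke),$$ $$S(ke,km)=\overline c\langle g\rangle.V(ke,km)\ \big|\ d(x).[x=g]P(ke,km),$$ $$\mathit{System}_g=\,!\,\nu ke.\nu km.\,!\,S(ke,km),\qquad \mathit{Spec}_g=\,!\,\nu ke.\nu km.\,S(ke,km).$$ **Theorem.** $\mathit{System}_g$ is not $i$-simulated by $\mathit{Spec}_g$. Moreover, the formula $$\phi=\langle d\,g\rangle\langle\overline c(g_1)\rangle\langle\overline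 c(g_2)\rangle\Big(g_1=g\wedge g_2=g\wedge\langle\overline c(nt_1)\rangle\langle d\,nt_1\rangle\langle d\,nt_1\rangle\langle\overline c(u_1)\rangle\langle\overline c(u_2)\rangle\big(nt_1\ne g\wedge u_1\ne g\wedge u_2\ne g\wedge\langle d\,u_1\rangle\langle\overline c(w)\rangle(w\ne g)\wedge\langle d\,u_2\rangle\langle\overline c(w)\rangle(w\ne g)\big)\Big)$$ is in the simulation fragment of $\mathcal{FM}$, $\mathit{System}_g\vDash\phi$, and $\mathit{Spec}_g\nvDash\phi$. -/

import Mathlib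

/-! # The non-interleaving applied pi-calculus, interleaving similarity, the logic FM, and BAC

Terms up to alpha-conversion are represented by de Bruijn indices. Variables are natural numbers:
under `n` binders the indices `0, …, n - 1` refer to these binders (`0` being the innermost one) and
the index `x + n` is the free variable `x`. A freshness condition "`x` does not occur in `e`" on a
binder is expressed by the fact that `e` lives outside that binder and is shifted when it is moved
under it. -/

namespace AppliedPi

/-! ## Messages and the equational theory -/

/-- A located alias `sλ`: a location prefix `s` in `{0,1}*` (`false` is `0`, `true` is `1`) and an
alias variable `λ`. -/
structure Alias where
  pre : List Bool
  idx : ℕ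
deriving DecidableEq

/-- Messages over the signature `pair, fst, snd, enc, dec, mac`. -/
inductive Msg where
  | var (x : ℕ)
  | ali (α : Alias)
  | pair (M N : Msg)
  | fst (M : Msg)
  | snd (M : Msg)
  | enc (M K : Msg)
  | dec (M K : Msg)
  | mac (M K : Msg)

namespace Msg

/-- Simultaneous substitution: variables by `s`, aliases by `σ`. -/
def bind (s : ℕ → Msg) (σ : Alias → Msg) : Msg → Msg
  | var x => s x
  | ali α => σ α
  | pair M N => pair (M.bind s σ) (N.bind s σ)
  | fst M => fst (M.bind s σ)
  | snd M => snd (M.bind s σ)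
  | enc M K => enc (M.bind s σ) (K.bind s σ)
  | dec M K => dec (M.bind s σ) (K.bind s σ)
  | mac M K => mac (M.bind s σ) (K.bind s σ)

/-- Substitution of messages for variables. -/
def subst (s : ℕ → Msg) (M : Msg) : Msg := M.bind s ali

/-- Substitution of messages for aliases. -/
def asubst (σ : Alias → Msg) (M : Msg) : Msg := M.bind var σ

/-- Renaming of variables. -/
def rename (f : ℕ → ℕ) (M : Msg) : Msg := M.subst (fun x => var (f x))

/-- Move a message under `k` binders. -/
def shift (k : ℕ) (M : Msg) : Msg := M.rename (fun x => x + k)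

/-- The aliases of a message. -/
def fal : Msg → Set Alias
  | var _ => ∅
  | ali α => {α}
  | pair M N => M.fal ∪ N.fal
  | fst M => M.fal
  | snd M => M.fal
  | enc M K => M.fal ∪ K.fal
  | dec M K => M.fal ∪ K.fal
  | mac M K => M.fal ∪ K.fal

end Msg

/-- The equational theory `E`: the congruence generated by `fst ⟨M, N⟩ = M`, `snd ⟨M, N⟩ = N` and
`dec (enc M K) K = M`, for all messages `M`, `N`, `K`. -/
inductive EqE : Msg → Msg → Prop
  | refl (M) : EqE M M
  | symm {M N} : EqE M N → EqE N M
  | trans {M N K} : EqE M N → EqE N K → EqE M K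
  | pair {M M' N N'} : EqE M M' → EqE N N' → EqE (.pair M N) (.pair M' N')
  | fst {M M'} : EqE M M' → EqE (.fst M) (.fst M')
  | snd {M M'} : EqE M M' → EqE (.snd M) (.snd M')
  | enc {M M' K K'} : EqE M M' → EqE K K' → EqE (.enc M K) (.enc M' K')
  | dec {M M' K K'} : EqE M M' → EqE K K' → EqE (.dec M K) (.dec M' K')
  | mac {M M' K K'} : EqE M M' → EqE K K' → EqE (.mac M K) (.mac M' K')
  | fst_pair (M N) : EqE (.fst (.pair M N)) M
  | snd_pair (M N) : EqE (.snd (.pair M N)) N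
  | dec_enc (M K) : EqE (.dec (.enc M K) K) M

/-- Extend a substitution or a renaming to one more variable, the new index `0`. -/
def scons {T : Type} (a : T) (s : ℕ → T) : ℕ → T
  | 0 => a
  | x + 1 => s x

/-- A substitution, moved under one binder. -/
def up (s : ℕ → Msg) : ℕ → Msg := scons (.var 0) (fun x => (s x).shift 1)

/-! ## Processes -/

/-- The two syntactic categories of the grammar of processes. -/
inductive Kind where
  | guarded
  | plain

/-- The grammar of guarded processes (`Term .guarded`) and of processes (`Term .plain`). Every
guarded process is a process: this is why the constructors of the guarded grammar are available at
both kinds. Choice is restricted to guarded summands. -/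
inductive Term : Kind → Type where
  /-- deadlock -/
  | nil : Term .plain
  /-- `P | Q` -/
  | par : Term .plain → Term .plain → Term .plain
  /-- replication `!P` -/
  | bang : Term .plain → Term .plain
  /-- `νx.P`; binds the index `0` in `P` -/
  | nu {κ : Kind} : Term κ → Term κ
  /-- `[M = N]P` -/
  | mat {κ : Kind} : Msg → Msg → Term κ → Term κ
  /-- input `M(x).P`; binds the index `0` in `P` -/
  | inp {κ : Kind} : Msg → Term .plain → Term κ
  /-- output of `N` on `M`, then `P` -/
  | out {κ : Kind} : Msg → Msg → Term .plain → Term κ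
  /-- `G + H` -/
  | choice {κ : Kind} : Term .guarded → Term .guarded → Term κ

abbrev Proc : Type := Term .plain

namespace Term

/-- Capture-avoiding substitution. -/
def subst : {κ : Kind} → (ℕ → Msg) → Term κ → Term κ
  | _, _, nil => nil
  | _, s, par P Q => par (P.subst s) (Q.subst s)
  | _, s, bang P => bang (P.subst s)
  | _, s, nu P => nu (P.subst (up s))
  | _, s, mat M N P => mat (M.subst s) (N.subst s) (P.subst s)
  | _, s, inp M P => inp (M.subst s) (P.subst (up s))
  | _, s, out M N P => out (M.subst s) (N.subst s) (P.subst s)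
  | _, s, choice G H => choice (G.subst s) (H.subst s)

/-- Renaming of variables. -/
def rename {κ : Kind} (f : ℕ → ℕ) (P : Term κ) : Term κ := P.subst (fun x => .var (f x))

/-- Move a process under `k` binders. -/
def shift {κ : Kind} (k : ℕ) (P : Term κ) : Term κ := P.rename (fun x => x + k)

/-- Replace the variable bound by the binder just removed by `N`. -/
def inst {κ : Kind} (P : Term κ) (N : Msg) : Term κ := P.subst (scons N .var)

end Term

/-! ## Extended processes -/

/-- Substitutions on aliases. -/
abbrev ASubst : Type := Alias → Msg

namespace ASubst

/-- The identity substitution. -/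
def one : ASubst := Msg.ali

/-- The substitution that maps `α` to `N` and every other alias to itself. -/
def single (α : Alias) (N : Msg) : ASubst := Function.update one α N

def dom (σ : ASubst) : Set Alias := {α | σ α ≠ .ali α}

def shift (k : ℕ) (σ : ASubst) : ASubst := fun α => (σ α).shift k

end ASubst

/-- The extended process `νx₁. … νxₖ.(σ | P)`. The `k` binders bind the indices `0, …, k - 1` in
the messages of `σ` and in `P`. -/
structure ExtProc where
  k : ℕ
  σ : ASubst
  P : Proc

namespace ExtProc

def dom (A : ExtProc) : Set Alias := A.σ.dom

/-- A process `P` as the extended process `id | P`. -/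
def ofProc (P : Proc) : ExtProc := ⟨0, ASubst.one, P⟩

end ExtProc

/-! ## Labelled transitions -/

/-- Early action labels: free input `M N`, output of the alias `α` on `M`, interaction. -/
inductive Act where
  | inp (M N : Msg)
  | out (M : Msg) (α : Alias)
  | tau

namespace Act

def shift (k : ℕ) : Act → Act
  | inp M N => inp (M.shift k) (N.shift k)
  | out M α => out (M.shift k) α
  | tau => tau

/-- The aliases of a label; the alias that an output introduces is not one of them. -/
def fal : Act → Set Alias
  | inp M N => M.fal ∪ N.fal
  | out M _ => M.fal
  | tau => ∅

/-- Apply an alias substitution to the messages of a label that is an input or `τ`, and to the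
channel of an output. -/
def asubst (σ : ASubst) : Act → Act
  | inp M N => inp (M.asubst σ) (N.asubst σ)
  | out M α => out (M.asubst σ) α
  | tau => tau

def IsOut : Act → Prop
  | out _ _ => True
  | _ => False

end Act

/-- A location `s[t]`. -/
structure Loc where
  s : List Bool
  t : List Bool

/-- A location label: one location, or a pair of locations (output, input). -/
inductive LocLabel where
  | one (l : Loc)
  | two (l₀ l₁ : Loc)

def Loc.cons (b : Bool) (l : Loc) : Loc := ⟨b :: l.s, l.t⟩

def LocLabel.cons (b : Bool) : LocLabel → LocLabel
  | one l => one (l.cons b)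
  | two l₀ l₁ => two (l₀.cons b) (l₁.cons b)

/-- Exchange two adjacent blocks of binders: the `j` innermost ones and the `k` ones around them. -/
def swapRen (j k : ℕ) (x : ℕ) : ℕ := if x < j then x + k else if x < j + k then x - j else x

/-- Insert `j` binders around the `k` innermost ones. -/
def insertRen (k j : ℕ) (x : ℕ) : ℕ := if x < k then x else x + j

/-- Transitions of processes. -/
inductive PStep : {κ : Kind} → Term κ → Act → LocLabel → ExtProc → Prop
  | inp {κ : Kind} {M K N : Msg} {P : Proc} :
      EqE M K →
      PStep (.inp K P : Term κ) (.inp M N) (.one ⟨[], []⟩) ⟨0, ASubst.one, P.inst N⟩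
  | out {κ : Kind} {M K N : Msg} {P : Proc} (l : ℕ) :
      EqE M K →
      PStep (.out K N P : Term κ) (.out M ⟨[], l⟩) (.one ⟨[], []⟩)
        ⟨0, ASubst.single ⟨[], l⟩ N, P⟩
  | parL {P Q R : Proc} {π : Act} {u : LocLabel} {k : ℕ} {σ : ASubst} :
      PStep P π u ⟨k, σ, R⟩ →
      PStep (.par P Q) π (u.cons false) ⟨k, σ, .par R (Q.shift k)⟩
  | parR {P Q R : Proc} {π : Act} {u : LocLabel} {k : ℕ} {σ : ASubst} :
      PStep Q π u ⟨k, σ, R⟩ →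
      PStep (.par P Q) π (u.cons true) ⟨k, σ, .par (P.shift k) R⟩
  | ext {κ : Kind} {P : Term κ} {π : Act} {u : LocLabel} {k : ℕ} {σ : ASubst} {R : Proc} :
      PStep P (π.shift 1) u ⟨k, σ, R⟩ →
      PStep (.nu P) π u ⟨k + 1, σ, R⟩
  | sumL {κ : Kind} {G H : Term .guarded} {π : Act} {t : List Bool} {A : ExtProc} :
      PStep G π (.one ⟨[], t⟩) A →
      PStep (.choice G H : Term κ) π (.one ⟨[], false :: t⟩) A
  | sumR {κ : Kind} {G H : Term .guarded} {π : Act} {t : List Bool} {A : ExtProc} :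
      PStep H π (.one ⟨[], t⟩) A →
      PStep (.choice G H : Term κ) π (.one ⟨[], true :: t⟩) A
  | mat {κ : Kind} {M N : Msg} {P : Term κ} {π : Act} {u : LocLabel} {A : ExtProc} :
      PStep P π u A → EqE M N →
      PStep (.mat M N P) π u A
  | bang {P : Proc} {π : Act} {u : LocLabel} {A : ExtProc} :
      PStep (.par P (.bang P)) π u A →
      PStep (.bang P) π u A
  /-- The receiver is moved under the `k` names that the sender extrudes. -/
  | closeL {P Q P' Q' : Proc} {M N : Msg} {l k j : ℕ} {l₀ l₁ : Loc} :
      PStep P (.out M ⟨[], l⟩) (.one l₀) ⟨k, ASubst.single ⟨[], l⟩ N, P'⟩ →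
      PStep (Q.shift k) (.inp (M.shift k) N) (.one l₁) ⟨j, ASubst.one, Q'⟩ →
      PStep (.par P Q) .tau (.two (l₀.cons false) (l₁.cons true))
        ⟨k + j, ASubst.one, .par (P'.shift j) Q'⟩
  /-- As before, with the receiver on the left; in the result the `j` names of the receiver are
  bound outside of the `k` names of the sender. -/
  | closeR {P Q P' Q' : Proc} {M N : Msg} {l k j : ℕ} {l₀ l₁ : Loc} :
      PStep (P.shift k) (.inp (M.shift k) N) (.one l₀) ⟨j, ASubst.one, P'⟩ →
      PStep Q (.out M ⟨[], l⟩) (.one l₁) ⟨k, ASubst.single ⟨[], l⟩ N, Q'⟩ →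
      PStep (.par P Q) .tau (.two (l₁.cons true) (l₀.cons false))
        ⟨j + k, ASubst.one, .par (P'.rename (swapRen j k)) (Q'.rename (insertRen k j))⟩

/-- Transitions of extended processes. -/
inductive Step : ExtProc → Act → LocLabel → ExtProc → Prop
  | res {k k' : ℕ} {σ σ' : ASubst} {P P' : Proc} {π : Act} {u : LocLabel} :
      Step ⟨k, σ, P⟩ (π.shift 1) u ⟨k', σ', P'⟩ →
      Step ⟨k + 1, σ, P⟩ π u ⟨k' + 1, σ', P'⟩
  /-- As `N` and the messages in the range of `σ` contain no alias, the composition of `σ` with the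
  new entry is the update of `σ`. -/
  | aliasOut {k : ℕ} {σ : ASubst} {P Q : Proc} {M N : Msg} {l : ℕ} {s t : List Bool} :
      PStep P (.out (M.asubst σ) ⟨[], l⟩) (.one ⟨s, t⟩) ⟨k, ASubst.single ⟨[], l⟩ N, Q⟩ →
      M.fal ⊆ σ.dom → (⟨s, l⟩ : Alias) ∉ σ.dom →
      Step ⟨0, σ, P⟩ (.out M ⟨s, l⟩) (.one ⟨s, t⟩)
        ⟨k, Function.update (σ.shift k) ⟨s, l⟩ N, Q⟩
  | aliasFree {k : ℕ} {σ : ASubst} {P Q : Proc} {π : Act} {u : LocLabel} :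
      ¬ π.IsOut →
      PStep P (π.asubst σ) u ⟨k, ASubst.one, Q⟩ →
      π.fal ⊆ σ.dom →
      Step ⟨0, σ, P⟩ π u ⟨k, σ.shift k, Q⟩

/-! ## Static tests and interleaving similarity -/

/-- `A ⊨ M = N`. -/
def ExtProc.Test (A : ExtProc) (M N : Msg) : Prop :=
  EqE ((M.shift A.k).asubst A.σ) ((N.shift A.k).asubst A.σ)

/-- A map between aliases, as a substitution. -/
def aren (ρ : Alias → Alias) : ASubst := fun α => .ali (ρ α)

/-- `R` (a relation between extended processes, indexed by a bijection `ρ : dom A → dom B`) is an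
interleaving simulation. The bijection is given by a map on all aliases; only its restriction to
`dom A` is ever used. -/
def IsISimulation (R : (Alias → Alias) → ExtProc → ExtProc → Prop) : Prop :=
  ∀ ρ A B, R ρ A B →
    Set.BijOn ρ A.dom B.dom ∧
    (∀ π u A', ¬ π.IsOut → Step A π u A' →
      ∃ u' B', Step B (π.asubst (aren ρ)) u' B' ∧ R ρ A' B') ∧
    (∀ M α u A', Step A (.out M α) u A' →
      ∃ α' u' B', Step B (.out (M.asubst (aren ρ)) α') u' B' ∧
        R (Function.update ρ α α') A' B') ∧
    (∀ M N, M.fal ⊆ A.dom → N.fal ⊆ A.dom →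
      (A.Test M N ↔ B.Test (M.asubst (aren ρ)) (N.asubst (aren ρ))))

/-- `A` is `i`-simulated by `B`. -/
def ISimulatedBy (A B : ExtProc) : Prop :=
  ∃ R, IsISimulation R ∧ R id A B

/-! ## The modal logic FM -/

/-- Formulas of FM. The output modality binds the index `0` in its body. -/
inductive Formula where
  | tru
  | eq (M N : Msg)
  | and (φ ψ : Formula)
  | neg (φ : Formula)
  | diaTau (φ : Formula)
  | diaIn (M N : Msg) (φ : Formula)
  | diaOut (M : Msg) (φ : Formula)

namespace Formula

/-- Capture-avoiding substitution. -/
def subst : (ℕ → Msg) → Formula → Formula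
  | _, tru => tru
  | s, eq M N => eq (M.subst s) (N.subst s)
  | s, and φ ψ => and (φ.subst s) (ψ.subst s)
  | s, neg φ => neg (φ.subst s)
  | s, diaTau φ => diaTau (φ.subst s)
  | s, diaIn M N φ => diaIn (M.subst s) (N.subst s) (φ.subst s)
  | s, diaOut M φ => diaOut (M.subst s) (φ.subst (up s))

/-- Replace the variable bound by the output modality just removed by `N`. -/
def inst (φ : Formula) (N : Msg) : Formula := φ.subst (scons N .var)

/-- The aliases of a formula. -/
def fal : Formula → Set Alias
  | tru => ∅
  | eq M N => M.fal ∪ N.fal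
  | and φ ψ => φ.fal ∪ ψ.fal
  | neg φ => φ.fal
  | diaTau φ => φ.fal
  | diaIn M N φ => M.fal ∪ N.fal ∪ φ.fal
  | diaOut M φ => M.fal ∪ φ.fal

def size : Formula → ℕ
  | tru => 0
  | eq _ _ => 0
  | and φ ψ => φ.size + ψ.size + 1
  | neg φ => φ.size + 1
  | diaTau φ => φ.size + 1
  | diaIn _ _ φ => φ.size + 1
  | diaOut _ φ => φ.size + 1

theorem size_subst (φ : Formula) : ∀ s, (φ.subst s).size = φ.size := by
  induction φ with
  | tru => intro s; rfl
  | eq M N => intro s; rfl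
  | and φ ψ h₁ h₂ => intro s; simp [subst, size, h₁, h₂]
  | neg φ h => intro s; simp [subst, size, h]
  | diaTau φ h => intro s; simp [subst, size, h]
  | diaIn M N φ h => intro s; simp [subst, size, h]
  | diaOut M φ h => intro s; simp [subst, size, h]

/-- The simulation fragment: negation is applied to equalities only. -/
def InSimulationFragment : Formula → Prop
  | tru => True
  | eq _ _ => True
  | and φ ψ => φ.InSimulationFragment ∧ ψ.InSimulationFragment
  | neg φ => ∃ M N, φ = eq M N
  | diaTau φ => φ.InSimulationFragment
  | diaIn _ _ φ => φ.InSimulationFragment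
  | diaOut _ φ => φ.InSimulationFragment

/-- `M ≠ N`. -/
def ne (M N : Msg) : Formula := neg (eq M N)

end Formula

/-- Satisfaction `A ⊨ φ`. -/
def Sat : ExtProc → Formula → Prop
  | _, .tru => True
  | A, .eq M N => A.Test M N
  | A, .and φ ψ => Sat A φ ∧ Sat A ψ
  | A, .neg φ => ¬ Sat A φ
  | A, .diaTau φ => ∃ u B, Step A .tau u B ∧ Sat B φ
  | A, .diaIn M N φ => ∃ u B, Step A (.inp M N) u B ∧ Sat B φ
  | A, .diaOut M φ =>
      ∃ α u B, Step A (.out M α) u B ∧ α ∉ φ.fal ∧ Sat B (φ.inst (.ali α))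
termination_by _ φ => φ.size
decreasing_by all_goals simp [Formula.size, Formula.inst, Formula.size_subst]

/-! ## The BAC protocol with a leading `getChallenge` message -/

/-- The pair of `m` and its MAC under the key `km`. -/
def withMac (m km : Msg) : Msg := .pair m (.mac m km)

/-- The prover (ePassport)
`νnt. out c nt. d(y). [snd y = mac(fst y, km)] [nt = fst (snd (dec (fst y) ke))]`
`νkt. let m = enc(⟨nt, ⟨fst (dec (fst y) ke), kt⟩⟩, ke) in out c ⟨m, mac(m, km)⟩`.
The names `nt`, `y`, `kt` are bound in this order. -/
def prover (c d ke km : Msg) : Proc :=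
  .nu <| .out (c.shift 1) (.var 0) <| .inp (d.shift 1) <|
    .mat (.snd (.var 0)) (.mac (.fst (.var 0)) (km.shift 2)) <|
    .mat (.var 1) (.fst (.snd (.dec (.fst (.var 0)) (ke.shift 2)))) <|
    .nu <| .out (c.shift 3)
      (withMac
        (.enc (.pair (.var 2) (.pair (.fst (.dec (.fst (.var 1)) (ke.shift 3))) (.var 0)))
          (ke.shift 3))
        (km.shift 3))
      .nil

/-- The verifier (reader)
`d(nt). νnr. νkr. let m = enc(⟨nr, ⟨nt, kr⟩⟩, ke) in out c ⟨m, mac(m, km)⟩`.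
The names `nt`, `nr`, `kr` are bound in this order. -/
def verifier (c d ke km : Msg) : Proc :=
  .inp d <| .nu <| .nu <| .out (c.shift 3)
    (withMac (.enc (.pair (.var 1) (.pair (.var 2) (.var 0))) (ke.shift 3)) (km.shift 3))
    .nil

/-- `out c g. V(c, d, ke, km) | d(x). [x = g] P(c, d, ke, km)`, where `g` is `getChallenge`. -/
def session (c d g ke km : Msg) : Proc :=
  .par
    (.out c g (verifier c d ke km))
    (.inp d (.mat (.var 0) (g.shift 1)
      (prover (c.shift 1) (d.shift 1) (ke.shift 1) (km.shift 1))))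

/-- `!νke. νkm. !(session)`: an ePassport may be used in any number of sessions. The free variables
`c`, `d`, `g` are the output channel, the input channel and `getChallenge`. -/
def systemGet (c d g : ℕ) : Proc :=
  .bang <| .nu <| .nu <| .bang <|
    session (.var (c + 2)) (.var (d + 2)) (.var (g + 2)) (.var 1) (.var 0)

/-- `!νke. νkm. (session)`: an ePassport is used in at most one session. -/
def specGet (c d g : ℕ) : Proc :=
  .bang <| .nu <| .nu <|
    session (.var (c + 2)) (.var (d + 2)) (.var (g + 2)) (.var 1) (.var 0)

/-- The attack formula
`⟨d g⟩⟨out c (g₁)⟩⟨out c (g₂)⟩(g₁ = g ∧ g₂ = g ∧`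
`⟨out c (nt₁)⟩⟨d nt₁⟩⟨d nt₁⟩⟨out c (u₁)⟩⟨out c (u₂)⟩(nt₁ ≠ g ∧ u₁ ≠ g ∧ u₂ ≠ g ∧`
`⟨d u₁⟩⟨out c (w)⟩(w ≠ g) ∧ ⟨d u₂⟩⟨out c (w)⟩(w ≠ g)))`. -/
def attackFormula (c d g : ℕ) : Formula :=
  .diaIn (.var d) (.var g) <| .diaOut (.var c) <| .diaOut (.var (c + 1)) <|
    .and (.eq (.var 1) (.var (g + 2))) <|
    .and (.eq (.var 0) (.var (g + 2))) <|
    .diaOut (.var (c + 2)) <|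
    .diaIn (.var (d + 3)) (.var 0) <|
    .diaIn (.var (d + 3)) (.var 0) <|
    .diaOut (.var (c + 3)) <|
    .diaOut (.var (c + 4)) <|
    .and (.ne (.var 2) (.var (g + 5))) <|
    .and (.ne (.var 1) (.var (g + 5))) <|
    .and (.ne (.var 0) (.var (g + 5))) <|
    .and
      (.diaIn (.var (d + 5)) (.var 1) <| .diaOut (.var (c + 5)) <|
        .ne (.var 0) (.var (g + 6)))
      (.diaIn (.var (d + 5)) (.var 0) <| .diaOut (.var (c + 5)) <|
        .ne (.var 0) (.var (g + 6)))

end AppliedPi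

/-! In the system, all sessions of one passport share `ke` and `km`, so one passport can run next to
two readers that hold its keys. The attacker wakes the passport, feeds its nonce to both readers and
collects two replies. The passport still waits for one reply and would accept either. The last
conjunction of the formula tests both continuations from this single state. In the specification a
MAC key belongs to one reader and one passport only, so the two replies carry different keys and the
single waiting passport cannot accept both.

`wit_system` exhibits the run of the system. For the specification, a state is abstracted to a
multiset of threads that records protocol stages and MAC keys and forgets channels, encryption keys
and the nonce test. This over-approximates the behaviour (`Rep.succ`), which suffices for proving
that a run is impossible. The argument in `mstep_replies` is a count of the threads that are ready
to send something other than `g`. An input raises the count by at most one, and each such output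
lowers it by exactly one. Two outputs after the nonce thus force both inputs of the nonce to go to
readers. The MAC test then equates the passport's key with the keys of two different readers.

Failure of similarity follows because simulations preserve the simulation fragment.
`Wit.sat_of_simulation` proves this for derivations `Wit`, with the aliases of the formula renamed
along the bijection. -/

namespace AppliedPi

/-! ### Substitution calculus for messages. -/

namespace Msg

theorem bind_bind (M : Msg) (s s' : ℕ → Msg) (σ σ' : Alias → Msg) :
    (M.bind s σ).bind s' σ' = M.bind (fun x => (s x).bind s' σ') (fun α => (σ α).bind s' σ') := by
  induction M <;> simp_all [bind]

@[simp] theorem bind_var_ali (M : Msg) : M.bind var ali = M := by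
  induction M <;> simp_all [bind]

theorem shift_eq_bind (k : ℕ) (M : Msg) : M.shift k = M.bind (fun x => var (x + k)) ali := rfl

theorem subst_eq_bind (s : ℕ → Msg) (M : Msg) : M.subst s = M.bind s ali := rfl

@[simp] theorem shift_zero (M : Msg) : M.shift 0 = M := bind_var_ali M

@[simp] theorem shift_shift (j k : ℕ) (M : Msg) : (M.shift j).shift k = M.shift (j + k) := by
  simp [shift_eq_bind, bind_bind, bind, add_assoc]

@[simp] theorem shift_var (k x : ℕ) : (var x).shift k = var (x + k) := rfl
@[simp] theorem shift_ali (k : ℕ) (α : Alias) : (ali α).shift k = ali α := rfl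
@[simp] theorem shift_pair (k : ℕ) (M N : Msg) :
    (pair M N).shift k = pair (M.shift k) (N.shift k) := rfl
@[simp] theorem shift_enc (k : ℕ) (M N : Msg) :
    (enc M N).shift k = enc (M.shift k) (N.shift k) := rfl
@[simp] theorem shift_mac (k : ℕ) (M N : Msg) :
    (mac M N).shift k = mac (M.shift k) (N.shift k) := rfl

@[simp] theorem subst_var (s : ℕ → Msg) (x : ℕ) : (var x).subst s = s x := rfl
@[simp] theorem subst_ali (s : ℕ → Msg) (α : Alias) : (ali α).subst s = ali α := rfl
@[simp] theorem subst_pair (s : ℕ → Msg) (M N : Msg) :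
    (pair M N).subst s = pair (M.subst s) (N.subst s) := rfl
@[simp] theorem subst_fst (s : ℕ → Msg) (M : Msg) : (fst M).subst s = fst (M.subst s) := rfl
@[simp] theorem subst_snd (s : ℕ → Msg) (M : Msg) : (snd M).subst s = snd (M.subst s) := rfl
@[simp] theorem subst_enc (s : ℕ → Msg) (M N : Msg) :
    (enc M N).subst s = enc (M.subst s) (N.subst s) := rfl
@[simp] theorem subst_dec (s : ℕ → Msg) (M N : Msg) :
    (dec M N).subst s = dec (M.subst s) (N.subst s) := rfl
@[simp] theorem subst_mac (s : ℕ → Msg) (M N : Msg) :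
    (mac M N).subst s = mac (M.subst s) (N.subst s) := rfl

@[simp] theorem asubst_var (σ : Alias → Msg) (x : ℕ) : (var x).asubst σ = var x := rfl
@[simp] theorem asubst_ali (σ : Alias → Msg) (α : Alias) : (ali α).asubst σ = σ α := rfl

theorem subst_shift (k : ℕ) (s : ℕ → Msg) (M : Msg) :
    (M.shift k).subst s = M.subst (fun x => s (x + k)) := by
  simp [shift_eq_bind, subst_eq_bind, bind_bind, bind]

theorem shift_subst (k : ℕ) (s : ℕ → Msg) (M : Msg) :
    (M.subst s).shift k = M.subst (fun x => (s x).shift k) := by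
  simp [shift_eq_bind, subst_eq_bind, bind_bind, bind]

end Msg

@[simp] theorem scons_zero {T : Type} (a : T) (s : ℕ → T) : scons a s 0 = a := rfl
@[simp] theorem scons_succ {T : Type} (a : T) (s : ℕ → T) (x : ℕ) : scons a s (x + 1) = s x := rfl
@[simp] theorem up_zero (s : ℕ → Msg) : up s 0 = .var 0 := rfl
@[simp] theorem up_succ (s : ℕ → Msg) (x : ℕ) : up s (x + 1) = (s x).shift 1 := rfl
@[simp] theorem up_one (s : ℕ → Msg) : up s 1 = (s 0).shift 1 := rfl
@[simp] theorem up_two (s : ℕ → Msg) : up s 2 = (s 1).shift 1 := rfl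

namespace Msg

@[simp] theorem shift_one_subst_up (s : ℕ → Msg) (M : Msg) :
    (M.shift 1).subst (up s) = (M.subst s).shift 1 := by
  simp [subst_shift, shift_subst]

@[simp] theorem shift_two_subst_up (s : ℕ → Msg) (M : Msg) :
    (M.shift 2).subst (up (up s)) = (M.subst s).shift 2 := by
  simp [subst_shift, shift_subst]

@[simp] theorem shift_three_subst_up (s : ℕ → Msg) (M : Msg) :
    (M.shift 3).subst (up (up (up s))) = (M.subst s).shift 3 := by
  simp [subst_shift, shift_subst]

@[simp] theorem shift_one_inst (N M : Msg) : (M.shift 1).subst (scons N var) = M := by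
  rw [subst_shift]
  exact bind_var_ali M

end Msg

/-! ## Normal forms for the equational theory -/

namespace Msg

open Classical in
/-- Normal form with respect to the equations, oriented from left to right. -/
noncomputable def nf : Msg → Msg
  | var x => var x
  | ali α => ali α
  | pair M N => pair M.nf N.nf
  | fst M => match M.nf with
    | pair M₁ _ => M₁
    | M' => fst M'
  | snd M => match M.nf with
    | pair _ M₂ => M₂
    | M' => snd M'
  | enc M K => enc M.nf K.nf
  | dec M K => match M.nf with
    | enc M₁ K₁ => if K₁ = K.nf then M₁ else dec (enc M₁ K₁) K.nf
    | M' => dec M' K.nf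
  | mac M K => mac M.nf K.nf

end Msg

/-- `nf` is computed bottom-up, so it respects congruence, and it contracts each of the three
redexes at its root. -/
theorem EqE.nf_eq {M N : Msg} (h : EqE M N) : M.nf = N.nf := by
  induction h with
  | dec _ _ h₁ h₂ => rw [Msg.nf, Msg.nf, h₁, h₂]
  | _ => simp_all [Msg.nf]

theorem eqE_nf (M : Msg) : EqE M M.nf := by
  induction M with
  | var x => exact .refl _
  | ali α => exact .refl _
  | pair M N h₁ h₂ => exact .pair h₁ h₂
  | enc M N h₁ h₂ => exact .enc h₁ h₂
  | mac M N h₁ h₂ => exact .mac h₁ h₂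
  | fst M h =>
    refine (EqE.fst h).trans ?_
    simp only [Msg.nf]
    split
    · rename_i e; rw [e]; exact .fst_pair _ _
    · exact .refl _
  | snd M h =>
    refine (EqE.snd h).trans ?_
    simp only [Msg.nf]
    split
    · rename_i e; rw [e]; exact .snd_pair _ _
    · exact .refl _
  | dec M K h₁ h₂ =>
    refine (EqE.dec h₁ h₂).trans ?_
    simp only [Msg.nf]
    split
    · rename_i e
      split
      · rename_i e'; rw [e, e']; exact .dec_enc _ _
      · rw [e]; exact .refl _
    · exact .refl _

/-- The source of all inequalities below: two messages are separated by computing their normal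
forms. -/
theorem eqE_iff_nf {M N : Msg} : EqE M N ↔ M.nf = N.nf :=
  ⟨EqE.nf_eq, fun h => (eqE_nf M).trans (h ▸ (eqE_nf N).symm)⟩

@[simp] theorem eqE_var_iff {x y : ℕ} : EqE (.var x) (.var y) ↔ x = y := by
  simp [eqE_iff_nf, Msg.nf]

theorem EqE.bind {M N : Msg} (h : EqE M N) (s : ℕ → Msg) (σ : Alias → Msg) :
    EqE (M.bind s σ) (N.bind s σ) := by
  induction h with
  | refl M => exact .refl _
  | symm _ h => exact .symm h
  | trans _ _ h₁ h₂ => exact .trans h₁ h₂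
  | pair _ _ h₁ h₂ => exact .pair h₁ h₂
  | fst _ h => exact .fst h
  | snd _ h => exact .snd h
  | enc _ _ h₁ h₂ => exact .enc h₁ h₂
  | dec _ _ h₁ h₂ => exact .dec h₁ h₂
  | mac _ _ h₁ h₂ => exact .mac h₁ h₂
  | fst_pair M N => exact .fst_pair _ _
  | snd_pair M N => exact .snd_pair _ _
  | dec_enc M K => exact .dec_enc _ _

theorem Msg.shift_leftInverse (k : ℕ) (M : Msg) :
    (M.shift k).subst (fun x => .var (x - k)) = M := by
  rw [Msg.subst_shift]
  simp only [Nat.add_sub_cancel]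
  exact Msg.bind_var_ali M

-- Subtraction on indices is a substitution that undoes the shift, and `EqE` is stable under
-- substitution. Tests can therefore be moved between binder depths.
@[simp] theorem eqE_shift_iff {k : ℕ} {M N : Msg} : EqE (M.shift k) (N.shift k) ↔ EqE M N := by
  refine ⟨fun h => ?_, fun h => h.bind _ _⟩
  have := h.bind (fun x => .var (x - k)) Msg.ali
  rwa [← Msg.subst_eq_bind, ← Msg.subst_eq_bind, Msg.shift_leftInverse,
    Msg.shift_leftInverse] at this

/-! ## Intermediate states of the protocol -/

/-- The reader waiting to output its reply to `N`. -/
def verifierReply (c ke km N : Msg) : Proc :=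
  .nu <| .nu <| .out (c.shift 2)
    (withMac (.enc (.pair (.var 1) (.pair (N.shift 2) (.var 0))) (ke.shift 2)) (km.shift 2)) .nil

/-- The ePassport waiting for `getChallenge`. -/
def proverStart (c d g ke km : Msg) : Proc :=
  .inp d (.mat (.var 0) (g.shift 1) (prover (c.shift 1) (d.shift 1) (ke.shift 1) (km.shift 1)))

/-- The last message of the ePassport with nonces `nt` and `kt` in response to `y`. -/
def proverReply (ke km nt kt y : Msg) : Msg :=
  withMac (.enc (.pair nt (.pair (.fst (.dec (.fst y) ke)) kt)) ke) km

/-- The ePassport that has received `y` after sending `nt`. -/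
def proverCheck (c ke km nt y : Msg) : Proc :=
  .mat (.snd y) (.mac (.fst y) km) <| .mat nt (.fst (.snd (.dec (.fst y) ke))) <|
    .nu <| .out (c.shift 1)
      (proverReply (ke.shift 1) (km.shift 1) (nt.shift 1) (.var 0) (y.shift 1)) .nil

/-- The ePassport that has sent `nt`. -/
def proverWait (c d ke km nt : Msg) : Proc :=
  .inp d (proverCheck (c.shift 1) (ke.shift 1) (km.shift 1) (nt.shift 1) (.var 0))

theorem session_eq (c d g ke km : Msg) :
    session c d g ke km = .par (.out c g (verifier c d ke km)) (proverStart c d g ke km) := rfl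

theorem prover_eq (c d ke km : Msg) :
    prover c d ke km = .nu (.out (c.shift 1) (.var 0)
      (proverWait (c.shift 1) (d.shift 1) (ke.shift 1) (km.shift 1) (.var 0))) := by
  simp [prover, proverWait, proverCheck, proverReply]

@[simp] theorem verifier_subst (s : ℕ → Msg) (c d ke km : Msg) :
    (verifier c d ke km).subst s
      = verifier (c.subst s) (d.subst s) (ke.subst s) (km.subst s) := by
  simp [verifier, Term.subst, withMac]

@[simp] theorem verifierReply_subst (s : ℕ → Msg) (c ke km N : Msg) :
    (verifierReply c ke km N).subst s
      = verifierReply (c.subst s) (ke.subst s) (km.subst s) (N.subst s) := by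
  simp [verifierReply, Term.subst, withMac]

@[simp] theorem proverCheck_subst (s : ℕ → Msg) (c ke km nt y : Msg) :
    (proverCheck c ke km nt y).subst s
      = proverCheck (c.subst s) (ke.subst s) (km.subst s) (nt.subst s) (y.subst s) := by
  simp [proverCheck, proverReply, Term.subst, withMac]

@[simp] theorem proverWait_subst (s : ℕ → Msg) (c d ke km nt : Msg) :
    (proverWait c d ke km nt).subst s
      = proverWait (c.subst s) (d.subst s) (ke.subst s) (km.subst s) (nt.subst s) := by
  simp [proverWait, Term.subst]

@[simp] theorem prover_subst (s : ℕ → Msg) (c d ke km : Msg) :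
    (prover c d ke km).subst s
      = prover (c.subst s) (d.subst s) (ke.subst s) (km.subst s) := by
  simp [prover_eq, Term.subst]

@[simp] theorem proverStart_subst (s : ℕ → Msg) (c d g ke km : Msg) :
    (proverStart c d g ke km).subst s
      = proverStart (c.subst s) (d.subst s) (g.subst s) (ke.subst s) (km.subst s) := by
  simp [proverStart, Term.subst]

@[simp] theorem session_subst (s : ℕ → Msg) (c d g ke km : Msg) :
    (session c d g ke km).subst s
      = session (c.subst s) (d.subst s) (g.subst s) (ke.subst s) (km.subst s) := by
  simp [session_eq, Term.subst]

theorem verifier_eq (c d ke km : Msg) :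
    verifier c d ke km
      = .inp d (verifierReply (c.shift 1) (ke.shift 1) (km.shift 1) (.var 0)) := by
  simp [verifier, verifierReply]

theorem Term.shift_eq_subst {κ : Kind} (k : ℕ) (P : Term κ) :
    P.shift k = P.subst (fun x => .var (x + k)) := rfl

theorem Msg.subst_eq_shift (k : ℕ) (M : Msg) : M.subst (fun x => .var (x + k)) = M.shift k := rfl

/-! ## The reachable states of the specification -/

/-- The threads of the specification that can still act; `km` is the index of the MAC key. The
stages `v0, v1, v2` are those of a reader, `p0, …, p3` those of an ePassport. -/
inductive Thread where
  | v0 (km : ℕ)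
  | v1 (km : ℕ)
  | v2 (km : ℕ)
  | p0 (km : ℕ)
  | p1 (km : ℕ)
  | p2 (km : ℕ)
  | p3
deriving DecidableEq

namespace Thread

def shift (k : ℕ) : Thread → Thread
  | v0 km => v0 (km + k)
  | v1 km => v1 (km + k)
  | v2 km => v2 (km + k)
  | p0 km => p0 (km + k)
  | p1 km => p1 (km + k)
  | p2 km => p2 (km + k)
  | p3 => p3

end Thread

open Thread

/-- `Leaf g P M`: the process `P`, in which `getChallenge` has the index `g`, runs the threads `M`.
A guard that fails and a session that has not started yet run no thread. -/
inductive Leaf (g : ℕ) : Proc → Multiset Thread → Prop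
  | nil : Leaf g .nil 0
  | dead {M N : Msg} {P : Proc} : ¬ EqE M N → Leaf g (.mat M N P) 0
  | fresh {c d : Msg} :
      Leaf g (.nu (.nu (session (c.shift 2) (d.shift 2) (.var (g + 2)) (.var 1) (.var 0)))) 0
  | v0 {c c' d ke : Msg} {km : ℕ} :
      Leaf g (.out c (.var g) (verifier c' d ke (.var km))) {v0 km}
  | v1 {c d ke : Msg} {km : ℕ} : Leaf g (verifier c d ke (.var km)) {v1 km}
  | v2 {c ke N : Msg} {km : ℕ} : Leaf g (verifierReply c ke (.var km) N) {v2 km}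
  | p0 {c d ke : Msg} {km : ℕ} : Leaf g (proverStart c d (.var g) ke (.var km)) {p0 km}
  | p1 {c d ke N : Msg} {km : ℕ} : EqE N (.var g) →
      Leaf g (.mat N (.var g) (prover c d ke (.var km))) {p1 km}
  | p2 {c d ke nt : Msg} {km : ℕ} : Leaf g (proverWait c d ke (.var km) nt) {p2 km}
  | p3 {c ke km nt y : Msg} : Leaf g (proverCheck c ke km nt y) {p3}

/-- Parallel compositions of leaves and of replicated sessions. -/
inductive Rep (g : ℕ) : {κ : Kind} → Term κ → Multiset Thread → Prop
  | leaf {P : Proc} {M : Multiset Thread} : Leaf g P M → Rep g P M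
  | par {P Q : Proc} {M N : Multiset Thread} : Rep g P M → Rep g Q N → Rep g (.par P Q) (M + N)
  | bang {P : Proc} : Leaf g P 0 → Rep g (.bang P) 0

theorem Leaf.shift {g : ℕ} {P : Proc} {M : Multiset Thread} (h : Leaf g P M) (k : ℕ) :
    Leaf (g + k) (P.shift k) (M.map (Thread.shift k)) := by
  cases h with
  | nil => exact .nil
  | dead h => exact .dead (fun h' => h (eqE_shift_iff.1 h'))
  | @fresh c d =>
    have := @Leaf.fresh (g + k) (c.shift k) (d.shift k)
    simpa [Term.shift_eq_subst, Term.subst, Msg.subst_eq_shift, add_right_comm _ k 2,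
      add_comm k 2, add_assoc] using this
  | v0 => rw [Term.shift_eq_subst, Term.subst, verifier_subst]; exact .v0
  | v1 => rw [Term.shift_eq_subst, verifier_subst]; exact .v1
  | v2 => rw [Term.shift_eq_subst, verifierReply_subst]; exact .v2
  | p0 => rw [Term.shift_eq_subst, proverStart_subst]; exact .p0
  | @p1 c d ke N km h =>
    have : Leaf (g + k) _ _ := .p1 (c := c.shift k) (d := d.shift k) (ke := ke.shift k)
      (km := km + k) (eqE_shift_iff (k := k).2 h)
    simpa [Term.shift_eq_subst, Term.subst, Msg.subst_eq_shift, Thread.shift] using this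
  | p2 => rw [Term.shift_eq_subst, proverWait_subst]; exact .p2
  | p3 => rw [Term.shift_eq_subst, proverCheck_subst]; exact .p3

theorem Rep.shift {g : ℕ} {κ : Kind} {P : Term κ} {M : Multiset Thread} (h : Rep g P M) (k : ℕ) :
    Rep (g + k) (P.shift k) (M.map (Thread.shift k)) := by
  induction h with
  | leaf h => exact .leaf (h.shift k)
  | par _ _ h₁ h₂ => rw [Multiset.map_add]; exact .par h₁ h₂
  | bang h => exact .bang (h.shift k)

/-- The messages that visible actions carry. -/
inductive Ev where
  | inp (N : Msg)
  | out (N : Msg)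

/-- The event `e` is that of a transition with the action `π` and the active substitution `σ`. -/
def Ev.Of (π : Act) (σ : ASubst) : Ev → Prop
  | inp N => σ = ASubst.one ∧ ∃ M, π = .inp M N
  | out N => ∃ M α, π = .out M α ∧ σ = ASubst.single α N

/-- Moves of single threads; `k` is the number of new binders, under which the result lives. -/
inductive TStep (g : ℕ) : Multiset Thread → Ev → ℕ → Multiset Thread → Prop
  | fresh_out : TStep g 0 (.out (.var (g + 2))) 2 ({v1 0} + {p0 0})
  | fresh_inp {N : Msg} : EqE N (.var g) → TStep g 0 (.inp N) 2 ({v0 0} + {p1 0})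
  | fresh_inp_dead {N : Msg} : ¬ EqE N (.var g) → TStep g 0 (.inp N) 2 {v0 0}
  | v0 {km : ℕ} : TStep g {v0 km} (.out (.var g)) 0 {v1 km}
  | v1 {km : ℕ} {N : Msg} : TStep g {v1 km} (.inp N) 0 {v2 km}
  | v2 {km : ℕ} {m : Msg} : TStep g {v2 km} (.out (withMac m (.var (km + 2)))) 2 0
  | p0 {km : ℕ} {N : Msg} : EqE N (.var g) → TStep g {p0 km} (.inp N) 0 {p1 km}
  | p0_dead {km : ℕ} {N : Msg} : ¬ EqE N (.var g) → TStep g {p0 km} (.inp N) 0 0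
  | p1 {km : ℕ} : TStep g {p1 km} (.out (.var 0)) 1 {p2 (km + 1)}
  | p2 {km : ℕ} {N : Msg} : EqE (.snd N) (.mac (.fst N) (.var km)) →
      TStep g {p2 km} (.inp N) 0 {p3}
  | p2_dead {km : ℕ} {N : Msg} : ¬ EqE (.snd N) (.mac (.fst N) (.var km)) →
      TStep g {p2 km} (.inp N) 0 0
  | p3 {N : Msg} : TStep g {p3} (.out N) 1 0

/-- Moves of a multiset of threads. -/
def MStep (g : ℕ) (M : Multiset Thread) (e : Ev) (k : ℕ) (M' : Multiset Thread) : Prop :=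
  ∃ S M₀ T, M = S + M₀ ∧ TStep g S e k T ∧ M' = T + M₀.map (Thread.shift k)

theorem MStep.add_right {g k : ℕ} {M M' : Multiset Thread} {e : Ev} (h : MStep g M e k M')
    (N : Multiset Thread) : MStep g (M + N) e k (M' + N.map (Thread.shift k)) := by
  obtain ⟨S, M₀, T, rfl, h, rfl⟩ := h
  exact ⟨S, M₀ + N, T, add_assoc _ _ _, h, by simp [add_assoc]⟩

theorem MStep.add_left {g k : ℕ} {M M' : Multiset Thread} {e : Ev} (h : MStep g M e k M')
    (N : Multiset Thread) : MStep g (N + M) e k (N.map (Thread.shift k) + M') := by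
  simpa only [add_comm] using h.add_right N

theorem TStep.mstep {g k : ℕ} {S T : Multiset Thread} {e : Ev} (h : TStep g S e k T) :
    MStep g S e k T :=
  ⟨S, 0, T, by simp, h, by simp⟩

/-- What a visible transition from a state with the threads `M` leads to. -/
def Succ (g : ℕ) (M : Multiset Thread) (π : Act) (A : ExtProc) : Prop :=
  ∃ e M', Ev.Of π A.σ e ∧ MStep g M e A.k M' ∧ Rep (g + A.k) A.P M'

/-! ### Inversion of process transitions. -/

theorem PStep.inp_inv {κ : Kind} {K : Msg} {P : Proc} {π : Act} {u : LocLabel} {A : ExtProc}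
    (h : PStep (.inp K P : Term κ) π u A) :
    ∃ M N, π = .inp M N ∧ EqE M K ∧ A = ⟨0, ASubst.one, P.inst N⟩ := by
  cases h with
  | inp h => exact ⟨_, _, rfl, h, rfl⟩

theorem PStep.out_inv {κ : Kind} {K N : Msg} {P : Proc} {π : Act} {u : LocLabel} {A : ExtProc}
    (h : PStep (.out K N P : Term κ) π u A) :
    ∃ M l, π = .out M ⟨[], l⟩ ∧ EqE M K ∧ A = ⟨0, ASubst.single ⟨[], l⟩ N, P⟩ := by
  cases h with
  | out l h => exact ⟨_, _, rfl, h, rfl⟩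

theorem PStep.nu_inv {κ : Kind} {P : Term κ} {π : Act} {u : LocLabel} {k : ℕ} {σ : ASubst}
    {R : Proc} (h : PStep (.nu P) π u ⟨k, σ, R⟩) :
    ∃ j, k = j + 1 ∧ PStep P (π.shift 1) u ⟨j, σ, R⟩ := by
  cases h with
  | ext h => exact ⟨_, rfl, h⟩

theorem PStep.mat_inv {κ : Kind} {M N : Msg} {P : Term κ} {π : Act} {u : LocLabel} {A : ExtProc}
    (h : PStep (.mat M N P) π u A) : EqE M N ∧ PStep P π u A := by
  cases h with
  | mat h h' => exact ⟨h', h⟩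

theorem PStep.par_inv {P Q : Proc} {π : Act} {u : LocLabel} {A : ExtProc}
    (h : PStep (.par P Q) π u A) (hπ : π ≠ .tau) :
    (∃ u R, PStep P π u ⟨A.k, A.σ, R⟩ ∧ A.P = .par R (Q.shift A.k)) ∨
    (∃ u R, PStep Q π u ⟨A.k, A.σ, R⟩ ∧ A.P = .par (P.shift A.k) R) := by
  cases h with
  | parL h => exact .inl ⟨_, _, h, rfl⟩
  | parR h => exact .inr ⟨_, _, h, rfl⟩
  | closeL => exact absurd rfl hπ
  | closeR => exact absurd rfl hπ

theorem Act.shift_shift (j k : ℕ) (π : Act) : (π.shift j).shift k = π.shift (j + k) := by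
  cases π <;> simp [Act.shift]

theorem Act.shift_inp_inv {k : ℕ} {π : Act} {M N : Msg} (h : π.shift k = .inp M N) :
    ∃ M' N', π = .inp M' N' ∧ M = M'.shift k ∧ N = N'.shift k := by
  cases π <;> simp_all [Act.shift]

theorem Act.shift_out_inv {k : ℕ} {π : Act} {M : Msg} {α : Alias} (h : π.shift k = .out M α) :
    ∃ M', π = .out M' α ∧ M = M'.shift k := by
  cases π <;> simp_all [Act.shift]

@[simp] theorem Term.shift_zero_proverStart (c d g ke km : Msg) :
    Term.shift 0 (proverStart c d g ke km) = proverStart c d g ke km := by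
  simp [Term.shift_eq_subst, Msg.subst_eq_bind]

theorem proverStart_inst (c d g ke km N : Msg) :
    Term.inst (.mat (.var 0) (g.shift 1)
      (prover (c.shift 1) (d.shift 1) (ke.shift 1) (km.shift 1))) N
      = .mat N g (prover c d ke km) := by
  simp [Term.inst, Term.subst]

theorem PStep.proverStart_inv {c d ke g km : Msg} {π : Act} {u : LocLabel} {A : ExtProc}
    (h : PStep (proverStart c d g ke km) π u A) :
    ∃ M N, π = .inp M N ∧ A = ⟨0, ASubst.one, .mat N g (prover c d ke km)⟩ := by
  obtain ⟨M, N, rfl, -, rfl⟩ := PStep.inp_inv h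
  exact ⟨M, N, rfl, by rw [proverStart_inst]⟩

/-- Each stage offers essentially one prefix, so inverting the transition determines the move. Where
the message received next meets a guard, the case split on that guard decides between a live and a
dead continuation. For the passport's reply only the MAC guard is examined, so `p3` may still be
stuck on the nonce test. -/
theorem Leaf.succ {g : ℕ} {P : Proc} {M : Multiset Thread} (hP : Leaf g P M) {π : Act}
    {u : LocLabel} {A : ExtProc} (h : PStep P π u A) (hπ : π ≠ .tau) : Succ g M π A := by
  cases hP with
  | nil => cases h
  | dead h' => exact absurd h.mat_inv.1 h'
  | fresh =>
    obtain ⟨k, σ, P⟩ := A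
    obtain ⟨k, rfl, h₁⟩ := h.nu_inv
    obtain ⟨k, rfl, h₂⟩ := h₁.nu_inv
    clear h h₁
    rw [Act.shift_shift] at h₂
    rcases h₂.par_inv (by cases π <;> simp_all [Act.shift]) with ⟨u, R, h, h'⟩ | ⟨u, R, h, h'⟩
    · obtain ⟨M, l, h'', -, h⟩ := h.out_inv
      obtain ⟨M, rfl, rfl⟩ := Act.shift_out_inv h''
      simp only at h'
      cases h
      subst h'
      refine ⟨.out _, _, ⟨_, _, rfl, rfl⟩, TStep.fresh_out.mstep, ?_⟩
      refine .par (.leaf .v1) (.leaf ?_)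
      exact (Term.shift_zero_proverStart _ _ _ _ _).symm ▸ .p0
    · obtain ⟨M, N, h'', h⟩ := h.proverStart_inv
      obtain ⟨M, N, rfl, rfl, rfl⟩ := Act.shift_inp_inv h''
      simp only at h'
      cases h
      subst h'
      -- The guard is evaluated below the two key binders, hence the shift by 2 when the leaf is
      -- built.
      by_cases hN : EqE N (.var g)
      · exact ⟨.inp _, _, ⟨rfl, _, rfl⟩, (TStep.fresh_inp hN).mstep,
          .par (.leaf (Leaf.v0.shift 0)) (.leaf (.p1 (eqE_shift_iff (k := 2).2 hN)))⟩
      · exact ⟨.inp _, _, ⟨rfl, _, rfl⟩, (TStep.fresh_inp_dead hN).mstep,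
          .par (.leaf (Leaf.v0.shift 0)) (.leaf (.dead (mt (eqE_shift_iff (k := 2) (N := .var g)).1 hN)))⟩
  | v0 =>
    obtain ⟨M, l, rfl, -, rfl⟩ := h.out_inv
    exact ⟨.out _, _, ⟨_, _, rfl, rfl⟩, TStep.v0.mstep, .leaf .v1⟩
  | v1 =>
    rw [verifier_eq] at h
    obtain ⟨M, N, rfl, -, rfl⟩ := h.inp_inv
    refine ⟨.inp _, _, ⟨rfl, _, rfl⟩, TStep.v1.mstep, .leaf ?_⟩
    simpa [Term.inst] using Leaf.v2
  | v2 =>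
    obtain ⟨k, σ, P⟩ := A
    obtain ⟨k, rfl, h₁⟩ := h.nu_inv
    obtain ⟨k, rfl, h₂⟩ := h₁.nu_inv
    clear h h₁
    rw [Act.shift_shift] at h₂
    obtain ⟨M, l, h'', -, h₃⟩ := h₂.out_inv
    obtain ⟨M, rfl, rfl⟩ := Act.shift_out_inv h''
    cases h₃
    exact ⟨.out _, _, ⟨_, _, rfl, rfl⟩, TStep.v2.mstep, .leaf .nil⟩
  | p0 =>
    obtain ⟨M, N, rfl, rfl⟩ := h.proverStart_inv
    by_cases hN : EqE N (.var g)
    · exact ⟨.inp _, _, ⟨rfl, _, rfl⟩, (TStep.p0 hN).mstep, .leaf (.p1 hN)⟩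
    · exact ⟨.inp _, _, ⟨rfl, _, rfl⟩, (TStep.p0_dead hN).mstep, .leaf (.dead hN)⟩
  | p1 h' =>
    obtain ⟨-, h⟩ := h.mat_inv
    rw [prover_eq] at h
    obtain ⟨k, σ, P⟩ := A
    obtain ⟨k, rfl, h₁⟩ := h.nu_inv
    obtain ⟨M, l, h'', -, h₃⟩ := h₁.out_inv
    obtain ⟨M, rfl, rfl⟩ := Act.shift_out_inv h''
    cases h₃
    exact ⟨.out _, _, ⟨_, _, rfl, rfl⟩, TStep.p1.mstep, .leaf .p2⟩
  | @p2 c d ke nt km =>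
    obtain ⟨M, N, rfl, -, rfl⟩ := h.inp_inv
    have e : Term.inst (proverCheck (c.shift 1) (ke.shift 1) ((Msg.var km).shift 1) (nt.shift 1)
        (.var 0)) N = proverCheck c ke (.var km) nt N := by
      simp [Term.inst]
    by_cases hN : EqE (.snd N) (.mac (.fst N) (.var km))
    · exact ⟨.inp _, _, ⟨rfl, _, rfl⟩, (TStep.p2 hN).mstep, .leaf (e ▸ .p3)⟩
    · exact ⟨.inp _, _, ⟨rfl, _, rfl⟩, (TStep.p2_dead hN).mstep, .leaf (e ▸ .dead hN)⟩
  | p3 =>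
    obtain ⟨-, h⟩ := h.mat_inv
    obtain ⟨-, h⟩ := h.mat_inv
    obtain ⟨k, σ, P⟩ := A
    obtain ⟨k, rfl, h₁⟩ := h.nu_inv
    obtain ⟨M, l, h'', -, h₃⟩ := h₁.out_inv
    obtain ⟨M, rfl, rfl⟩ := Act.shift_out_inv h''
    cases h₃
    exact ⟨.out _, _, ⟨_, _, rfl, rfl⟩, TStep.p3.mstep, .leaf .nil⟩

/-- The induction is on the transition, since unfolding a replication enlarges the process.
Components that do not move are only shifted under the new binders. -/
theorem Rep.succ {κ : Kind} {P : Term κ} {π : Act} {u : LocLabel} {A : ExtProc}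
    (h : PStep P π u A) (hπ : π ≠ .tau) {g : ℕ} {M : Multiset Thread} (hP : Rep g P M) :
    Succ g M π A := by
  induction h generalizing g M with
  | inp h => cases hP with | leaf hP => exact hP.succ (.inp h) hπ
  | out l h => cases hP with | leaf hP => exact hP.succ (.out l h) hπ
  | ext h => cases hP with | leaf hP => exact hP.succ (.ext h) hπ
  | mat h h' => cases hP with | leaf hP => exact hP.succ (.mat h h') hπ
  | sumL h => cases hP with | leaf hP => cases hP
  | sumR h => cases hP with | leaf hP => cases hP
  | parL h ih =>
    cases hP with
    | leaf hP => cases hP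
    | par hP hQ =>
      obtain ⟨e, M', he, hM, hR⟩ := ih hπ hP
      exact ⟨e, _, he, hM.add_right _, hR.par (hQ.shift _)⟩
  | parR h ih =>
    cases hP with
    | leaf hP => cases hP
    | par hP hQ =>
      obtain ⟨e, M', he, hM, hR⟩ := ih hπ hQ
      exact ⟨e, _, he, hM.add_left _, (hP.shift _).par hR⟩
  | bang h ih =>
    cases hP with
    | leaf hP => cases hP
    -- The unfolded copy may remain unstarted beside the replication. As it runs no thread, the
    -- multiset is unaffected.
    | bang hP => exact ih hπ (.par (.leaf hP) (.bang hP))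
  | closeL => exact absurd rfl hπ
  | closeR => exact absurd rfl hπ

/-! ## Transitions of extended processes -/

/-- Each use of `res` shifts the label once, so the underlying process sees it shifted past all
`A.k` binders before the active substitution is applied. -/
theorem Step.inp_inv {A A' : ExtProc} {M N : Msg} {u : LocLabel} (h : Step A (.inp M N) u A') :
    ∃ j, A'.k = A.k + j ∧ A'.σ = A.σ.shift j ∧
      PStep A.P (.inp ((M.shift A.k).asubst A.σ) ((N.shift A.k).asubst A.σ)) u
        ⟨j, ASubst.one, A'.P⟩ := by
  generalize hπ : Act.inp M N = π at h
  induction h generalizing M N with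
  | res _ ih =>
    subst hπ
    obtain ⟨j, h₁, h₂, h₃⟩ := ih rfl
    refine ⟨j, by simp only at h₁ ⊢; omega, h₂, ?_⟩
    simpa [Act.shift, add_comm] using h₃
  | aliasOut => cases hπ
  | aliasFree _ h _ =>
    subst hπ
    exact ⟨_, (Nat.zero_add _).symm, rfl, by simpa [Act.asubst] using h⟩

theorem Step.out_inv {A A' : ExtProc} {M : Msg} {α : Alias} {u : LocLabel}
    (h : Step A (.out M α) u A') :
    ∃ j N, A'.k = A.k + j ∧ A'.σ = Function.update (A.σ.shift j) α N ∧
      α ∉ A.dom ∧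
      PStep A.P (.out ((M.shift A.k).asubst A.σ) ⟨[], α.idx⟩) u
        ⟨j, ASubst.single ⟨[], α.idx⟩ N, A'.P⟩ := by
  generalize hπ : Act.out M α = π at h
  induction h generalizing M with
  | res _ ih =>
    subst hπ
    obtain ⟨j, N, h₁, h₂, h₃, h₄⟩ := ih rfl
    refine ⟨j, N, by simp only at h₁ ⊢; omega, h₂, h₃, ?_⟩
    simpa [Act.shift, add_comm] using h₄
  | aliasOut h _ h' =>
    cases hπ
    exact ⟨_, _, (Nat.zero_add _).symm, rfl, h', by simpa using h⟩
  | aliasFree h =>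
    subst hπ
    exact absurd trivial h

theorem Rep.step_inp {g : ℕ} {A A' : ExtProc} {M N : Msg} {u : LocLabel} {T : Multiset Thread}
    (hA : Rep (g + A.k) A.P T) (h : Step A (.inp M N) u A') :
    ∃ j T', A'.k = A.k + j ∧ A'.σ = A.σ.shift j ∧
      MStep (g + A.k) T (.inp ((N.shift A.k).asubst A.σ)) j T' ∧ Rep (g + A'.k) A'.P T' := by
  obtain ⟨j, h₁, h₂, h₃⟩ := h.inp_inv
  obtain ⟨e, T', he, hT, hA'⟩ := hA.succ h₃ (by simp)
  refine ⟨j, T', h₁, h₂, ?_, by rw [h₁, ← add_assoc]; exact hA'⟩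
  cases e with
  | inp N =>
    obtain ⟨-, M, hM⟩ := he
    cases hM
    exact hT
  | out N =>
    obtain ⟨M, α, hM, -⟩ := he
    cases hM

theorem Rep.step_out {g : ℕ} {A A' : ExtProc} {M : Msg} {α : Alias} {u : LocLabel}
    {T : Multiset Thread} (hA : Rep (g + A.k) A.P T) (h : Step A (.out M α) u A') :
    ∃ j N T', A'.k = A.k + j ∧ A'.σ = Function.update (A.σ.shift j) α N ∧
      MStep (g + A.k) T (.out N) j T' ∧ Rep (g + A'.k) A'.P T' := by
  obtain ⟨j, N, h₁, h₂, -, h₃⟩ := h.out_inv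
  obtain ⟨e, T', he, hT, hA'⟩ := hA.succ h₃ (by simp)
  refine ⟨j, N, T', h₁, h₂, ?_, by rw [h₁, ← add_assoc]; exact hA'⟩
  cases e with
  | inp N =>
    obtain ⟨-, M, hM⟩ := he
    cases hM
  | out N' =>
    obtain ⟨M, α', hM, hN⟩ := he
    cases hM
    -- Evaluating both singleton substitutions at the output alias identifies the messages sent.
    have := congrFun hN ⟨[], α.idx⟩
    simp only [ASubst.single, Function.update_self] at this
    exact this ▸ hT

/-! ## The specification does not satisfy the attack formula -/

/-- Threads that can produce an output different from `getChallenge`. -/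
def Thread.ready : Thread → ℕ
  | v2 _ => 1
  | p1 _ => 1
  | p3 => 1
  | _ => 0

/-- The number of ready threads. -/
def ready (M : Multiset Thread) : ℕ := (M.map Thread.ready).sum

@[simp] theorem ready_zero : ready 0 = 0 := rfl

@[simp] theorem ready_cons (t : Thread) (M : Multiset Thread) :
    ready (t ::ₘ M) = t.ready + ready M := by simp [ready]

@[simp] theorem ready_map_shift (k : ℕ) (M : Multiset Thread) :
    ready (M.map (Thread.shift k)) = ready M := by
  rw [ready, Multiset.map_map]
  congr 2
  funext t
  cases t <;> rfl

/-- An input activates at most one thread: a reader, a woken passport, or a passport that accepts a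
reply. -/
theorem MStep.ready_inp {g j : ℕ} {M M' : Multiset Thread} {N : Msg}
    (h : MStep g M (.inp N) j M') : ready M' ≤ ready M + 1 := by
  obtain ⟨S, M₀, T, rfl, h, rfl⟩ := h
  cases h <;> simp [Thread.ready] <;> omega

/-- The remaining outputs, by `v0` or a fresh session, send `g` and are excluded. The others consume
one ready thread and create none. -/
theorem MStep.ready_out {g j : ℕ} {M M' : Multiset Thread} {N : Msg}
    (h : MStep g M (.out N) j M') (hN : ¬ EqE N (.var (g + j))) : ready M = ready M' + 1 := by
  obtain ⟨S, M₀, T, rfl, h, rfl⟩ := h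
  cases h <;> simp [Thread.ready] at hN ⊢ <;> omega

/-- Only readers and ePassports that wait for `getChallenge`. -/
def Idle (Z : Multiset Thread) : Prop := ∀ t ∈ Z, ∃ km, t = v0 km ∨ t = p0 km

theorem Idle.shift {Z : Multiset Thread} (h : Idle Z) (k : ℕ) :
    Idle (Z.map (Thread.shift k)) := by
  intro t ht
  obtain ⟨t', ht', rfl⟩ := Multiset.mem_map.1 ht
  obtain ⟨km, rfl | rfl⟩ := h t' ht'
  · exact ⟨_, .inl rfl⟩
  · exact ⟨_, .inr rfl⟩

theorem Idle.ready_eq {Z : Multiset Thread} (h : Idle Z) : ready Z = 0 := by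
  refine Multiset.sum_eq_zero fun n hn => ?_
  obtain ⟨t, ht, rfl⟩ := Multiset.mem_map.1 hn
  obtain ⟨km, rfl | rfl⟩ := h t ht <;> rfl

theorem Thread.map_shift_zero (M : Multiset Thread) : M.map (Thread.shift 0) = M := by
  convert Multiset.map_id M with t
  cases t <;> rfl

/-- Rephrases a move through membership and `erase`, so that in a concrete multiset `simp` can
decide which thread moved. -/
theorem MStep.inp_cases {g j : ℕ} {M M' : Multiset Thread} {N : Msg}
    (h : MStep g M (.inp N) j M') :
    (j = 2 ∧ EqE N (.var g) ∧ M' = v0 0 ::ₘ p1 0 ::ₘ M.map (Thread.shift 2)) ∨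
    (j = 2 ∧ ¬ EqE N (.var g) ∧ M' = v0 0 ::ₘ M.map (Thread.shift 2)) ∨
    (j = 0 ∧ ∃ km,
      (v1 km ∈ M ∧ M' = v2 km ::ₘ M.erase (v1 km)) ∨
      (p0 km ∈ M ∧ EqE N (.var g) ∧ M' = p1 km ::ₘ M.erase (p0 km)) ∨
      (p0 km ∈ M ∧ ¬ EqE N (.var g) ∧ M' = M.erase (p0 km)) ∨
      (p2 km ∈ M ∧ EqE (.snd N) (.mac (.fst N) (.var km)) ∧ M' = p3 ::ₘ M.erase (p2 km)) ∨
      (p2 km ∈ M ∧ ¬ EqE (.snd N) (.mac (.fst N) (.var km)) ∧ M' = M.erase (p2 km))) := by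
  obtain ⟨S, M₀, T, rfl, h, rfl⟩ := h
  cases h with
  | fresh_inp h => left; simp [h]
  | fresh_inp_dead h => right; left; simp [h]
  | @v1 km => refine .inr (.inr ⟨rfl, km, .inl ?_⟩); simp [Thread.map_shift_zero]
  | @p0 km _ h => refine .inr (.inr ⟨rfl, km, .inr (.inl ?_)⟩); simp [Thread.map_shift_zero, h]
  | @p0_dead km _ h =>
    refine .inr (.inr ⟨rfl, km, .inr (.inr (.inl ?_))⟩); simp [Thread.map_shift_zero, h]
  | @p2 km _ h =>
    refine .inr (.inr ⟨rfl, km, .inr (.inr (.inr (.inl ?_)))⟩); simp [Thread.map_shift_zero, h]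
  | @p2_dead km _ h =>
    refine .inr (.inr ⟨rfl, km, .inr (.inr (.inr (.inr ?_)))⟩); simp [Thread.map_shift_zero, h]

theorem MStep.out_cases {g j : ℕ} {M M' : Multiset Thread} {N : Msg}
    (h : MStep g M (.out N) j M') :
    (j = 2 ∧ N = .var (g + 2) ∧ M' = v1 0 ::ₘ p0 0 ::ₘ M.map (Thread.shift 2)) ∨
    (∃ km, j = 0 ∧ N = .var g ∧ v0 km ∈ M ∧ M' = v1 km ::ₘ M.erase (v0 km)) ∨
    (∃ km m, j = 2 ∧ N = withMac m (.var (km + 2)) ∧ v2 km ∈ M ∧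
      M' = (M.erase (v2 km)).map (Thread.shift 2)) ∨
    (∃ km, j = 1 ∧ N = .var 0 ∧ p1 km ∈ M ∧
      M' = p2 (km + 1) ::ₘ (M.erase (p1 km)).map (Thread.shift 1)) ∨
    p3 ∈ M := by
  obtain ⟨S, M₀, T, rfl, h, rfl⟩ := h
  cases h with
  | fresh_out => left; simp
  | @v0 km => right; left; exact ⟨km, by simp [Thread.map_shift_zero]⟩
  | @v2 km m => right; right; left; exact ⟨km, m, by simp⟩
  | @p1 km => right; right; right; left; exact ⟨km, by simp⟩
  | p3 => simp

theorem not_eqE_withMac {m K : Msg} {x : ℕ} : ¬ EqE (withMac m K) (.var x) := by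
  simp [eqE_iff_nf, withMac, Msg.nf]

theorem mstep_start {g j : ℕ} {M : Multiset Thread} {N : Msg} (hN : EqE N (.var g))
    (h : MStep g 0 (.inp N) j M) : M = v0 0 ::ₘ p1 0 ::ₘ 0 := by
  have : j = 2 ∧ M = v0 0 ::ₘ {p1 0} := by simpa [hN] using h.inp_cases
  exact this.2

/-- A challenge comes either from the reader already present or from a new session. The passport's
output is a newly bound name and cannot equal `g`. -/
theorem mstep_challenge₁ {g j a : ℕ} {M : Multiset Thread} {N : Msg}
    (hN : EqE N (.var (g + j))) (h : MStep g (v0 a ::ₘ p1 a ::ₘ 0) (.out N) j M) :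
    (∃ a, M = v1 a ::ₘ p1 a ::ₘ 0) ∨
      ∃ a, M = v1 0 ::ₘ p0 0 ::ₘ v0 (a + 2) ::ₘ p1 (a + 2) ::ₘ 0 := by
  rcases h.out_cases with ⟨rfl, rfl, rfl⟩ | ⟨km, rfl, rfl, hm, rfl⟩ | ⟨km, m, rfl, rfl, hm, rfl⟩ |
    ⟨km, rfl, rfl, hm, rfl⟩ | hm
  · right; exact ⟨a, rfl⟩
  · simp at hm; subst hm; left; exact ⟨km, by simp⟩
  · simp at hm
  · simp at hN
  · simp at hm

/-- Every session has a single reader, so two challenges come from readers with different keys. -/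
theorem mstep_challenge₂ {g j a : ℕ} {M M' : Multiset Thread} {N : Msg}
    (hN : EqE N (.var (g + j)))
    (hM : M = v1 a ::ₘ p1 a ::ₘ 0 ∨ M = v1 0 ::ₘ p0 0 ::ₘ v0 (a + 2) ::ₘ p1 (a + 2) ::ₘ 0)
    (h : MStep g M (.out N) j M') :
    ∃ a b c Z, b ≠ c ∧ Idle Z ∧ M' = p1 a ::ₘ v1 b ::ₘ v1 c ::ₘ Z := by
  rcases h.out_cases with ⟨rfl, rfl, rfl⟩ | ⟨km, rfl, rfl, hm, rfl⟩ | ⟨km, m, rfl, rfl, hm, rfl⟩ |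
    ⟨km, rfl, rfl, hm, rfl⟩ | hm
  · rcases hM with rfl | rfl
    -- A new session binds its MAC key at index 0 and raises the older keys by 2, which separates
    -- the two readers.
    · refine ⟨a + 2, 0, a + 2, {p0 0}, by omega, by simp [Idle], ?_⟩
      simp only [Multiset.map_cons, Multiset.map_zero, Thread.shift, ← Multiset.cons_zero]
      ext t
      simp only [Multiset.count_cons]
      omega
    · refine ⟨a + 4, 0, 2, p0 0 ::ₘ p0 2 ::ₘ {v0 (a + 4)}, by omega, by simp [Idle], ?_⟩
      simp only [Multiset.map_cons, Multiset.map_zero, Thread.shift, add_assoc, Nat.reduceAdd,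
        zero_add, ← Multiset.cons_zero]
      ext t
      simp only [Multiset.count_cons]
      omega
  · rcases hM with rfl | rfl
    · simp at hm
    · simp at hm
      subst hm
      refine ⟨a + 2, a + 2, 0, {p0 0}, by omega, by simp [Idle], ?_⟩
      simp only [reduceCtorEq, Multiset.erase_cons_tail, ne_eq, not_false_eq_true,
        Multiset.erase_cons_head, ← Multiset.cons_zero]
      ext t
      simp only [Multiset.count_cons]
      omega
  · rcases hM with rfl | rfl <;> simp at hm
  · simp at hN
  · rcases hM with rfl | rfl <;> simp at hm

theorem Idle.not_mem {Z : Multiset Thread} (h : Idle Z) {t : Thread}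
    (h₁ : ∀ km, t ≠ v0 km) (h₂ : ∀ km, t ≠ p0 km) : t ∉ Z := fun ht => by
  obtain ⟨km, rfl | rfl⟩ := h t ht
  · exact h₁ _ rfl
  · exact h₂ _ rfl

/-- An output different from `getChallenge`, where the only ready threads are readers. -/
theorem mstep_reply {g j : ℕ} {M M' : Multiset Thread} {N : Msg}
    (hN : ¬ EqE N (.var (g + j))) (h : MStep g M (.out N) j M')
    (h₁ : ∀ km, p1 km ∉ M) (h₃ : p3 ∉ M) :
    ∃ km m, j = 2 ∧ N = withMac m (.var (km + 2)) ∧ v2 km ∈ M ∧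
      M' = (M.erase (v2 km)).map (Thread.shift 2) := by
  rcases h.out_cases with ⟨rfl, rfl, rfl⟩ | ⟨km, rfl, rfl, hm, rfl⟩ | h |
    ⟨km, rfl, rfl, hm, rfl⟩ | hm
  · simp at hN
  · simp at hN
  · exact h
  · exact absurd hm (h₁ _)
  · exact absurd hm h₃

theorem mstep_nonce {g j a b c : ℕ} {M Z : Multiset Thread} {N : Msg} (hbc : b ≠ c)
    (hZ : Idle Z) (hN : ¬ EqE N (.var (g + j)))
    (h : MStep g (p1 a ::ₘ v1 b ::ₘ v1 c ::ₘ Z) (.out N) j M) :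
    ∃ a b c Z, b ≠ c ∧ Idle Z ∧ N = .var 0 ∧ M = p2 a ::ₘ v1 b ::ₘ v1 c ::ₘ Z := by
  have h₂ : ∀ km, v2 km ∉ Z := fun km => hZ.not_mem (by simp) (by simp)
  have h₁ : ∀ km, p1 km ∉ Z := fun km => hZ.not_mem (by simp) (by simp)
  have h₃ : p3 ∉ Z := hZ.not_mem (by simp) (by simp)
  rcases h.out_cases with ⟨rfl, rfl, rfl⟩ | ⟨km, rfl, rfl, hm, rfl⟩ | ⟨km, m, rfl, rfl, hm, rfl⟩ |
    ⟨km, rfl, rfl, hm, rfl⟩ | hm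
  · simp at hN
  · simp at hN
  · simp [h₂] at hm
  · simp [h₁] at hm
    subst hm
    refine ⟨km + 1, b + 1, c + 1, _, by omega, hZ.shift 1, rfl, ?_⟩
    simp [Thread.shift]
  · simp [h₃] at hm

/-- `snd` of a variable is stuck, so a bare nonce never passes the MAC test. -/
theorem not_eqE_snd_var {x : ℕ} {m K : Msg} : ¬ EqE (.snd (.var x)) (.mac m K) := by
  simp [eqE_iff_nf, Msg.nf]

/-- Inputs of a nonce are only useful to readers. -/
theorem mstep_inp_var {g j x : ℕ} {M M' : Multiset Thread} (hx : x ≠ g)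
    (h : MStep g M (.inp (.var x)) j M') :
    ready M' ≤ ready M ∨ ∃ km, v1 km ∈ M ∧ M' = v2 km ::ₘ M.erase (v1 km) := by
  have hr : ∀ t ∈ M, ready (M.erase t) ≤ ready M := fun t ht => by
    conv_rhs => rw [← Multiset.cons_erase ht]
    simp
  rcases h.inp_cases with ⟨-, h, -⟩ | ⟨rfl, -, rfl⟩ | ⟨rfl, km, ⟨hm, rfl⟩ | ⟨-, h, -⟩ |
    ⟨hm, -, rfl⟩ | ⟨-, h, -⟩ | ⟨hm, -, rfl⟩⟩
  · exact absurd (eqE_var_iff.1 h) hx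
  · left; simp [Thread.ready]
  · exact .inr ⟨km, hm, rfl⟩
  · exact absurd (eqE_var_iff.1 h) hx
  · exact .inl (hr _ hm)
  · exact absurd h not_eqE_snd_var
  · exact .inl (hr _ hm)

/-- Inputs that make an ePassport ready carry the key of that ePassport. -/
theorem mstep_inp_ready {g j a : ℕ} {M Z : Multiset Thread} {N : Msg} (hZ : Idle Z)
    (hN : ¬ EqE N (.var g)) (h : MStep g (p2 a ::ₘ Z) (.inp N) j M) (hM : ready M ≠ 0) :
    EqE (.snd N) (.mac (.fst N) (.var a)) := by
  have h₁ : ∀ km, v1 km ∉ Z := fun km => hZ.not_mem (by simp) (by simp)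
  have h₂ : ∀ km, p2 km ∉ Z := fun km => hZ.not_mem (by simp) (by simp)
  have hr := hZ.ready_eq
  rcases h.inp_cases with ⟨-, h, -⟩ | ⟨rfl, -, rfl⟩ | ⟨rfl, km, ⟨hm, rfl⟩ | ⟨-, h, -⟩ |
    ⟨hm, -, rfl⟩ | ⟨hm, h, -⟩ | ⟨hm, -, rfl⟩⟩
  · exact absurd h hN
  · simp [Thread.ready, hr, Thread.shift] at hM
  · simp [h₁] at hm
  · exact absurd h hN
  · simp at hm
    rw [← Multiset.cons_erase hm] at hr
    simp [Thread.ready] at hr hM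
    omega
  · simp [h₂] at hm
    exact hm ▸ h
  · simp [h₂] at hm
    simp [hm, hr] at hM

/-- `mac` is a free constructor, so the normal form of a MAC determines its key. -/
theorem eqE_withMac {a b : ℕ} {m N : Msg} (h : N = withMac m (.var b))
    (h' : EqE (.snd N) (.mac (.fst N) (.var a))) : a = b := by
  subst h
  simpa [eqE_iff_nf, withMac, Msg.nf, eq_comm] using h'

/-- Two outputs different from `getChallenge` after two inputs of the same nonce are the replies of
two different readers. -/
theorem mstep_replies {g x j₁ j₂ j₃ j₄ a b c : ℕ} {Z M₁ M₂ M₃ M₄ : Multiset Thread} {N₃ N₄ : Msg}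
    (hbc : b ≠ c) (hZ : Idle Z) (hx : x ≠ g)
    (h₁ : MStep g (p2 a ::ₘ v1 b ::ₘ v1 c ::ₘ Z) (.inp (.var x)) j₁ M₁)
    (h₂ : MStep (g + j₁) M₁ (.inp (.var (x + j₁))) j₂ M₂)
    (h₃ : MStep (g + j₁ + j₂) M₂ (.out N₃) j₃ M₃)
    (h₄ : MStep (g + j₁ + j₂ + j₃) M₃ (.out N₄) j₄ M₄)
    (hN₃ : ¬ EqE N₃ (.var (g + j₁ + j₂ + j₃))) (hN₄ : ¬ EqE N₄ (.var (g + j₁ + j₂ + j₃ + j₄))) :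
    ∃ a b c m₃ m₄ Z, b ≠ c ∧ Idle Z ∧ N₃.shift j₄ = withMac m₃ (.var b) ∧
      N₄ = withMac m₄ (.var c) ∧ M₄ = p2 a ::ₘ Z := by
  have hr := hZ.ready_eq
  have r₃ := h₃.ready_out hN₃
  have r₄ := h₄.ready_out hN₄
  have n₁ : ∀ km, v1 km ∉ Z := fun km => hZ.not_mem (by simp) (by simp)
  have n₂ : ∀ km, v2 km ∉ Z := fun km => hZ.not_mem (by simp) (by simp)
  have n₃ : ∀ km, p1 km ∉ Z := fun km => hZ.not_mem (by simp) (by simp)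
  have n₄ : p3 ∉ Z := hZ.not_mem (by simp) (by simp)
  -- If the first input did not reach a reader, at most one thread would be ready after both inputs,
  -- whereas the two outputs consume two.
  have e₁ : ∃ b' c', b' ≠ c' ∧ M₁ = p2 a ::ₘ v2 b' ::ₘ v1 c' ::ₘ Z := by
    rcases mstep_inp_var hx h₁ with h | ⟨km, hm, rfl⟩
    · have := h₂.ready_inp
      simp [Thread.ready, hr] at h
      omega
    · simp [n₁] at hm
      rcases hm with rfl | rfl
      · refine ⟨km, c, hbc, ?_⟩
        simp [Multiset.cons_swap (v2 km)]
      · refine ⟨km, b, hbc.symm, ?_⟩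
        simp [hbc, Multiset.cons_swap (v2 km)]
  clear h₁ hbc
  obtain ⟨b, c, hbc, rfl⟩ := e₁
  have e₂ : M₂ = p2 a ::ₘ v2 b ::ₘ v2 c ::ₘ Z := by
    rcases mstep_inp_var (by omega) h₂ with h | ⟨km, hm, rfl⟩
    · simp [Thread.ready, hr] at h
      omega
    · simp [n₁] at hm
      subst hm
      simp [Multiset.cons_swap (v2 km)]
  subst e₂
  obtain ⟨km, m₃, rfl, rfl, hm, rfl⟩ := mstep_reply hN₃ h₃ (by simp [n₃]) (by simp [n₄])
  -- Whichever reader replies first, the one that remains holds the other key.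
  have e₃ : ∃ c', km ≠ c' ∧ (p2 a ::ₘ v2 b ::ₘ v2 c ::ₘ Z).erase (v2 km) = p2 a ::ₘ v2 c' ::ₘ Z := by
    simp [n₂] at hm
    rcases hm with rfl | rfl
    · exact ⟨c, hbc, by simp⟩
    · exact ⟨b, hbc.symm, by simp [hbc]⟩
  obtain ⟨c', hc', e₃⟩ := e₃
  have hZ' := hZ.shift 2
  have n₂' : ∀ km, v2 km ∉ Z.map (Thread.shift 2) := fun km => hZ'.not_mem (by simp) (by simp)
  have n₃' : ∀ km, p1 km ∉ Z.map (Thread.shift 2) := fun km => hZ'.not_mem (by simp) (by simp)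
  have n₄' : p3 ∉ Z.map (Thread.shift 2) := hZ'.not_mem (by simp) (by simp)
  rw [e₃, Multiset.map_cons, Multiset.map_cons, Thread.shift, Thread.shift] at h₄
  obtain ⟨km', m₄, rfl, rfl, hm', rfl⟩ := mstep_reply hN₄ h₄
    (fun km h => by simp [Multiset.mem_cons, n₃'] at h)
    (fun h => by simp [Multiset.mem_cons, n₄'] at h)
  simp only [Multiset.mem_cons, n₂', or_false, reduceCtorEq, false_or, v2.injEq] at hm'
  subst hm'
  refine ⟨a + 2 + 2, km + 2 + 2, c' + 2 + 2, m₃.shift 2, m₄, _, by omega, hZ'.shift 2,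
    by simp [withMac], rfl, ?_⟩
  simp [Thread.shift]

theorem not_sat_spec (c d g : ℕ) :
    ¬ Sat (.ofProc (specGet c d g)) (attackFormula c d g) := by
  intro h
  have r₀ : Rep (g + (ExtProc.ofProc (specGet c d g)).k) (ExtProc.ofProc (specGet c d g)).P 0 :=
    .bang (.fresh (c := .var c) (d := .var d))
  have hk : (ExtProc.ofProc (specGet c d g)).k = 0 := rfl
  generalize ExtProc.ofProc (specGet c d g) = A₀ at h r₀ hk
  simp only [attackFormula, Sat, Formula.inst, Formula.subst, Formula.ne, Msg.subst_var, scons_zero,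
    scons_succ, up_zero, up_succ, Msg.shift_ali, Msg.shift_var, Msg.subst_ali, Formula.fal, Msg.fal,
    ExtProc.Test, Msg.asubst_var, Msg.asubst_ali, Set.union_empty, Set.empty_union,
    Set.mem_empty_iff_false, Set.mem_singleton_iff, Set.mem_union, not_or, not_false_eq_true,
    true_and] at h
  obtain ⟨_, A₁, s₁, α₁, _, A₂, s₂, α₂, _, A₃, s₃, f₃, t₁, t₂, α₃, _, A₄, s₄, _, A₅, s₅, _, A₆, s₆,
    α₄, _, A₇, s₇, f₇, α₅, _, A₈, s₈, f₈, t₃, t₄, t₅, ⟨_, B₁, s₉, _, _, B₂, s₁₀, t₆⟩,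
    ⟨_, C₁, s₁₁, _, _, C₂, s₁₂, t₇⟩⟩ := h
  obtain ⟨j₁, M₁, k₁, σ₁, m₁, r₁⟩ := r₀.step_inp s₁
  obtain ⟨j₂, N₂, M₂, k₂, σ₂, m₂, r₂⟩ := r₁.step_out s₂
  obtain ⟨j₃, N₃, M₃, k₃, σ₃, m₃, r₃⟩ := r₂.step_out s₃
  obtain ⟨j₄, N₄, M₄, k₄, σ₄, m₄, r₄⟩ := r₃.step_out s₄
  obtain ⟨j₅, M₅, k₅, σ₅, m₅, r₅⟩ := r₄.step_inp s₅
  obtain ⟨j₆, M₆, k₆, σ₆, m₆, r₆⟩ := r₅.step_inp s₆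
  obtain ⟨j₇, N₇, M₇, k₇, σ₇, m₇, r₇⟩ := r₆.step_out s₇
  obtain ⟨j₈, N₈, M₈, k₈, σ₈, m₈, r₈⟩ := r₇.step_out s₈
  obtain ⟨j₉, M₉, k₉, σ₉, m₉, r₉⟩ := r₈.step_inp s₉
  obtain ⟨j₁₀, N₁₀, M₁₀, k₁₀, σ₁₀, m₁₀, -⟩ := r₉.step_out s₁₀
  obtain ⟨i₉, M₁₁, k₁₁, σ₁₁, m₁₁, r₁₁⟩ := r₈.step_inp s₁₁
  obtain ⟨i₁₀, N₁₂, M₁₂, k₁₂, σ₁₂, m₁₂, -⟩ := r₁₁.step_out s₁₂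
  -- The formula tests this message only after the next output. Cancelling the shift by `j₃` brings
  -- the test back to the state reached by sending it, and freshness of the second alias ensures
  -- that the entry was not overwritten.
  have u₁ : EqE N₂ (.var (g + A₁.k + j₂)) := by
    rw [← eqE_shift_iff (k := j₃)]
    simpa [σ₃, σ₂, k₃, k₂, ASubst.shift, add_assoc, Ne.symm f₃] using t₁
  have u₂ : EqE N₃ (.var (g + A₂.k + j₃)) := by
    simpa [σ₃, k₃, add_assoc] using t₂
  have u₃ : ¬ EqE N₄ (.var (g + A₃.k + j₄)) := by
    rw [← eqE_shift_iff (k := j₅ + j₆ + j₇ + j₈)]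
    simpa [σ₈, σ₇, σ₆, σ₅, σ₄, k₈, k₇, k₆, k₅, k₄, ASubst.shift, add_assoc, Ne.symm f₇,
      Ne.symm f₈.1] using t₃
  have u₄ : ¬ EqE N₇ (.var (g + A₄.k + j₅ + j₆ + j₇)) := by
    rw [← eqE_shift_iff (k := j₈)]
    simpa [σ₈, σ₇, k₈, k₇, k₆, k₅, ASubst.shift, add_assoc, Ne.symm f₈.2.1] using t₄
  have u₅ : ¬ EqE N₈ (.var (g + A₄.k + j₅ + j₆ + j₇ + j₈)) := by
    simpa [σ₈, k₈, k₇, k₆, k₅, add_assoc] using t₅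
  have u₆ : ¬ EqE N₁₀ (.var (g + B₁.k + j₁₀)) := by
    simpa [σ₁₀, k₁₀, add_assoc] using t₆
  have u₇ : ¬ EqE N₁₂ (.var (g + C₁.k + i₁₀)) := by
    simpa [σ₁₂, k₁₂, add_assoc] using t₇
  have e₁ := mstep_start (by simp) m₁
  subst e₁
  obtain ⟨a, b, c', Z, hbc, hZ, rfl⟩ : ∃ a b c Z, b ≠ c ∧ Idle Z ∧
      M₃ = p1 a ::ₘ v1 b ::ₘ v1 c ::ₘ Z := by
    rcases mstep_challenge₁ u₁ m₂ with ⟨a, h⟩ | ⟨a, h⟩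
    · exact mstep_challenge₂ u₂ (.inl h) m₃
    · exact mstep_challenge₂ u₂ (.inr h) m₃
  obtain ⟨a, b, c', Z, hbc, hZ, rfl, rfl⟩ := mstep_nonce hbc hZ u₃ m₄
  rw [show g + A₃.k + j₄ = g + A₄.k by omega] at u₃
  -- The unsimplified sum matches `x + j₁` in `mstep_replies` with `x = 0`, the index of the nonce
  -- when it is sent.
  have e₅ : A₅.σ α₃ = .var (0 + j₅) := by simp [σ₅, σ₄, ASubst.shift]
  simp only [Msg.shift_ali, Msg.asubst_ali, e₅] at m₆ m₅
  simp only [σ₄, Function.update_self] at m₅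
  rw [show g + A₅.k = g + A₄.k + j₅ by omega] at m₆
  rw [show g + A₆.k = g + A₄.k + j₅ + j₆ by omega] at m₇
  rw [show g + A₇.k = g + A₄.k + j₅ + j₆ + j₇ by omega] at m₈
  obtain ⟨a, b, c', n₃, n₄, Z, hbc, hZ, hn₃, hn₄, rfl⟩ :=
    mstep_replies hbc hZ (fun h => u₃ (by simp [h])) m₅ m₆ m₇ m₈ u₄ u₅
  have e₄ : A₈.σ α₄ = withMac n₃ (.var b) := by
    simpa [σ₈, σ₇, ASubst.shift, Ne.symm f₈.2.1] using hn₃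
  have e₅ : A₈.σ α₅ = withMac n₄ (.var c') := by simpa [σ₈] using hn₄
  simp only [Msg.shift_ali, Msg.asubst_ali] at m₉ m₁₁
  -- The further output shows that some thread is ready after the input, so the passport accepted
  -- the reply. Both branches start in `A₈`, hence concern the same key `a`.
  have v₁ := eqE_withMac e₄ (mstep_inp_ready hZ t₄ m₉ (by have := m₁₀.ready_out u₆; omega))
  have v₂ := eqE_withMac e₅ (mstep_inp_ready hZ t₅ m₁₁ (by have := m₁₂.ready_out u₇; omega))
  exact hbc (v₁.symm.trans v₂)

/-! ## The system satisfies the attack formula -/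

/-- Satisfaction for the simulation fragment, where moreover every alias that an output introduces
belongs to the domain afterwards. -/
inductive Wit : ExtProc → Formula → Prop
  | tru {A : ExtProc} : Wit A .tru
  | eq {A : ExtProc} {M N : Msg} : A.Test M N → Wit A (.eq M N)
  | ne {A : ExtProc} {M N : Msg} : ¬ A.Test M N → Wit A (.neg (.eq M N))
  | and {A : ExtProc} {φ ψ : Formula} : Wit A φ → Wit A ψ → Wit A (.and φ ψ)
  | diaTau {A B : ExtProc} {u : LocLabel} {φ : Formula} :
      Step A .tau u B → Wit B φ → Wit A (.diaTau φ)
  | diaIn {A B : ExtProc} {u : LocLabel} {M N : Msg} {φ : Formula} :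
      Step A (.inp M N) u B → Wit B φ → Wit A (.diaIn M N φ)
  | diaOut {A B : ExtProc} {u : LocLabel} {M : Msg} {α : Alias} {φ : Formula} :
      Step A (.out M α) u B → α ∉ φ.fal → α ∈ B.dom → Wit B (φ.inst (.ali α)) →
      Wit A (.diaOut M φ)

theorem Wit.sat {A : ExtProc} {φ : Formula} (h : Wit A φ) : Sat A φ := by
  induction h with
  | tru => simp [Sat]
  | eq h => simpa [Sat] using h
  | ne h => simpa [Sat] using h
  | and _ _ h₁ h₂ => simp [Sat, h₁, h₂]
  | diaTau h _ ih => rw [Sat]; exact ⟨_, _, h, ih⟩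
  | diaIn h _ ih => rw [Sat]; exact ⟨_, _, h, ih⟩
  | diaOut h h' _ _ ih => rw [Sat]; exact ⟨_, _, _, h, h', ih⟩

@[simp] theorem Msg.fal_shift (k : ℕ) (M : Msg) : (M.shift k).fal = M.fal := by
  induction M with
  | var x => rfl
  | ali α => rfl
  | fst M h => exact h
  | snd M h => exact h
  | pair M N h₁ h₂ => exact congrArg₂ _ h₁ h₂
  | enc M N h₁ h₂ => exact congrArg₂ _ h₁ h₂
  | dec M N h₁ h₂ => exact congrArg₂ _ h₁ h₂
  | mac M N h₁ h₂ => exact congrArg₂ _ h₁ h₂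

/-- A converse of `Step.inp_inv`, used to build runs without handling the binders one by one. -/
theorem Step.of_inp {k j : ℕ} {σ : ASubst} {P Q : Proc} {M N : Msg} {u : LocLabel}
    (h : PStep P (.inp ((M.shift k).asubst σ) ((N.shift k).asubst σ)) u ⟨j, ASubst.one, Q⟩)
    (hf : M.fal ∪ N.fal ⊆ σ.dom) :
    Step ⟨k, σ, P⟩ (.inp M N) u ⟨j + k, σ.shift j, Q⟩ := by
  induction k generalizing M N with
  | zero => exact .aliasFree (by simp [Act.IsOut]) (by simpa [Act.asubst] using h) hf
  | succ k ih => exact .res (ih (by simpa [add_comm] using h) (by simpa using hf))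

theorem Step.of_out {k j l : ℕ} {σ : ASubst} {P Q : Proc} {M N : Msg} {s t : List Bool}
    (h : PStep P (.out ((M.shift k).asubst σ) ⟨[], l⟩) (.one ⟨s, t⟩)
      ⟨j, ASubst.single ⟨[], l⟩ N, Q⟩)
    (hf : M.fal ⊆ σ.dom) (hl : (⟨s, l⟩ : Alias) ∉ σ.dom) :
    Step ⟨k, σ, P⟩ (.out M ⟨s, l⟩) (.one ⟨s, t⟩)
      ⟨j + k, Function.update (σ.shift j) ⟨s, l⟩ N, Q⟩ := by
  induction k generalizing M with
  | zero => exact .aliasOut (by simpa using h) hf hl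
  | succ k ih => exact .res (ih (by simpa [add_comm] using h) (by simpa using hf))

/-- Two sessions, given by `X`, `Y` and by `Z`, `W`, with replicated sessions `B` and `R`. -/
def twoSessions (X Y Z W B R : Proc) : Proc :=
  .par (.par (.par X Y) (.par (.par Z W) B)) R

/-- For a genuine reply to `nt` under the same keys, both guards hold by computing normal forms. -/
theorem PStep.proverCheck {c ke km nr nt kr y : Msg} {M : Msg} (hM : EqE M c)
    (hy : y = withMac (.enc (.pair nr (.pair nt kr)) ke) km) (l : ℕ) :
    PStep (AppliedPi.proverCheck c ke km nt y) (.out M ⟨[], l⟩) (.one ⟨[], []⟩)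
      ⟨1, ASubst.single ⟨[], l⟩ (proverReply (ke.shift 1) (km.shift 1) (nt.shift 1) (.var 0)
        (y.shift 1)), .nil⟩ := by
  subst hy
  refine .mat (.mat (.ext (.out l ?_)) ?_) ?_
  · exact eqE_shift_iff.2 hM
  · simp [eqE_iff_nf, withMac, Msg.nf]
  · simp [eqE_iff_nf, withMac, Msg.nf]

theorem PStep.verifierReply {c ke km N : Msg} {M : Msg} (hM : EqE M c) (l : ℕ) :
    PStep (AppliedPi.verifierReply c ke km N) (.out M ⟨[], l⟩) (.one ⟨[], []⟩)
      ⟨2, ASubst.single ⟨[], l⟩ (withMac (.enc (.pair (.var 1) (.pair (N.shift 2) (.var 0)))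
        (ke.shift 2)) (km.shift 2)), .nil⟩ := by
  refine .ext (.ext (.out l ?_))
  simpa [Act.shift] using eqE_shift_iff (k := 2).2 hM

theorem PStep.verifier {c d ke km M N : Msg} (hM : EqE M d) :
    PStep (AppliedPi.verifier c d ke km) (.inp M N) (.one ⟨[], []⟩)
      ⟨0, ASubst.one, AppliedPi.verifierReply c ke km N⟩ := by
  have := PStep.inp (κ := .plain) (N := N)
    (P := AppliedPi.verifierReply (c.shift 1) (ke.shift 1) (km.shift 1) (.var 0)) hM
  rw [verifier_eq]
  simpa [Term.inst] using this

theorem PStep.proverWait {c d ke km nt M N : Msg} (hM : EqE M d) :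
    PStep (AppliedPi.proverWait c d ke km nt) (.inp M N) (.one ⟨[], []⟩)
      ⟨0, ASubst.one, AppliedPi.proverCheck c ke km nt N⟩ := by
  have := PStep.inp (κ := .plain) (N := N)
    (P := AppliedPi.proverCheck (c.shift 1) (ke.shift 1) (km.shift 1) (nt.shift 1) (.var 0)) hM
  simpa [AppliedPi.proverWait, Term.inst] using this

theorem PStep.prover {c d ke km M : Msg} (hM : EqE M c) (l : ℕ) :
    PStep (AppliedPi.prover c d ke km) (.out M ⟨[], l⟩) (.one ⟨[], []⟩)
      ⟨1, ASubst.single ⟨[], l⟩ (.var 0), AppliedPi.proverWait (c.shift 1) (d.shift 1) (ke.shift 1)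
        (km.shift 1) (.var 0)⟩ := by
  rw [prover_eq]
  exact .ext (.out l (eqE_shift_iff.2 hM))

theorem PStep.proverStart {c d g ke km M N : Msg} (hM : EqE M d) :
    PStep (AppliedPi.proverStart c d g ke km) (.inp M N) (.one ⟨[], []⟩)
      ⟨0, ASubst.one, .mat N g (AppliedPi.prover c d ke km)⟩ := by
  rw [← proverStart_inst]
  exact .inp hM

theorem mem_dom_of_eq_withMac {σ : ASubst} {α : Alias} {m K : Msg} (h : σ α = withMac m K) :
    α ∈ σ.dom := by
  simp [ASubst.dom, h, withMac]

theorem mem_dom_of_eq_var {σ : ASubst} {α : Alias} {x : ℕ} (h : σ α = .var x) :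
    α ∈ σ.dom := by
  simp [ASubst.dom, h]

/-- An ePassport that waits for the reply of the reader accepts it and answers. -/
theorem wit_accept {c d g k : ℕ} {σ : ASubst} {C D ke km nr nt kr : Msg} {α : Alias}
    {X Z W B R : Proc} (hC : C = .var (c + k)) (hD : D = .var (d + k))
    (hα : σ α = withMac (.enc (.pair nr (.pair nt kr)) ke) km)
    (hσ : σ ⟨[false, false, true], 1⟩ = .ali ⟨[false, false, true], 1⟩) :
    Wit ⟨k, σ, twoSessions X (proverWait C D ke km nt) Z W B R⟩
      (.diaIn (.var d) (.ali α) (.diaOut (.var c) (.neg (.eq (.var 0) (.var (g + 1)))))) := by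
  subst hC hD
  refine .diaIn (Step.of_inp (.parL (.parL (.parR (.proverWait (.refl _)))))
    (by simpa [Msg.fal] using mem_dom_of_eq_withMac hα)) ?_
  refine .diaOut (Step.of_out (s := [false, false, true]) (t := [])
    (.parL (.parL (.parR (.proverCheck ?_ (nr := nr) (kr := kr) ?_ 1)))) ?_ ?_) ?_ ?_ (.ne ?_)
  · simp
  · simp [hα]
  · simp [Msg.fal]
  · simp [ASubst.dom, ASubst.shift, hσ]
  · simp [Formula.fal, Msg.fal]
  · simp [ExtProc.dom, ASubst.dom, proverReply, withMac]
  · simpa [ExtProc.Test, proverReply] using not_eqE_withMac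

/-- Two readers reply to the same nonce, and both replies are accepted. -/
theorem wit_replies {c d g k n : ℕ} {σ : ASubst} {C D ke km : Msg} {α : Alias} {W B R : Proc}
    (hC : C = .var (c + k)) (hD : D = .var (d + k))
    (hα : σ α = .var n) (hn : n ≠ g + k) (hσ : ∀ s, σ ⟨s, 1⟩ = .ali ⟨s, 1⟩) :
    Wit ⟨k, σ, twoSessions (verifierReply C ke km (.var n)) (proverWait C D ke km (.var n))
        (verifierReply C ke km (.var n)) W B R⟩
      (.diaOut (.var c) <| .diaOut (.var (c + 1)) <|
        .and (.neg (.eq (.ali α) (.var (g + 2)))) <|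
        .and (.neg (.eq (.var 1) (.var (g + 2)))) <|
        .and (.neg (.eq (.var 0) (.var (g + 2)))) <|
        .and
          (.diaIn (.var (d + 2)) (.var 1) <| .diaOut (.var (c + 2)) <|
            .neg (.eq (.var 0) (.var (g + 3))))
          (.diaIn (.var (d + 2)) (.var 0) <| .diaOut (.var (c + 2)) <|
            .neg (.eq (.var 0) (.var (g + 3))))) := by
  subst hC hD
  -- Aliases with index 1 are kept free for the outputs that follow the nonce, since `wit_system`
  -- uses index 0 at the same locations.
  have hα₁ : ∀ s, α ≠ ⟨s, 1⟩ := by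
    rintro s rfl
    simp [hσ] at hα
  refine .diaOut (Step.of_out (s := [false, false, false]) (t := []) (l := 1)
    (.parL (.parL (.parL (.verifierReply (.refl _) 1)))) ?_ ?_) ?_ ?_ ?_
  · simp [Msg.fal]
  · simp [ASubst.dom, hσ]
  · simp [Formula.fal, Msg.fal, (hα₁ _).symm]
  · simp [ExtProc.dom, ASubst.dom, withMac]
  simp only [Formula.inst, Formula.subst, Msg.subst_var, up_zero, up_succ, scons_succ,
    scons_zero, Msg.shift_var, Msg.shift_ali, Msg.subst_ali, Term.shift_eq_subst, Term.subst,
    proverWait_subst, verifierReply_subst, Msg.subst_eq_shift]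
  refine .diaOut (Step.of_out (s := [false, true, false, false]) (t := []) (l := 1)
    (.parL (.parR (.parL (.parL (.verifierReply ?_ 1))))) ?_ ?_) ?_ ?_ ?_
  · simp; omega
  · simp [Msg.fal]
  · simp [ASubst.dom, hσ, ASubst.shift]
  · simp [Formula.fal, Msg.fal, (hα₁ _).symm]
  · simp [ExtProc.dom, ASubst.dom, withMac]
  simp only [Formula.inst, Formula.subst, Msg.subst_var, up_zero, up_succ, scons_succ,
    scons_zero, Msg.shift_var, Msg.subst_ali, Term.shift_eq_subst, Term.subst,
    proverWait_subst, Msg.subst_eq_shift, Msg.shift_shift]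
  -- The nonces of the first reply lie below the two binders opened by the second one, hence their
  -- shift by 2.
  refine .and (.ne ?_) (.and (.ne ?_) (.and (.ne ?_) (.and
    (wit_accept (nr := (Msg.var 1).shift 2) (kr := (Msg.var 0).shift 2) ?_ ?_ ?_ ?_)
    (wit_accept (nr := .var 1) (kr := .var 0) ?_ ?_ ?_ ?_))))
  · simp [ExtProc.Test, hα₁, hα, ASubst.shift]; omega
  · simpa [ExtProc.Test, ASubst.shift, withMac] using not_eqE_withMac
  · simpa [ExtProc.Test, ASubst.shift, withMac] using not_eqE_withMac
  · simp; omega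
  · simp; omega
  · simp [ASubst.shift, withMac]
  · simp [ASubst.shift, hσ]
  · simp; omega
  · simp; omega
  · simp [withMac]
  · simp [ASubst.shift, hσ]

/-- Two sessions in which the ePassport has sent the nonce `n` and both readers wait for it. -/
theorem wit_nonce {c d g k n : ℕ} {σ : ASubst} {C D ke km : Msg} {α : Alias} {W B R : Proc}
    (hC : C = .var (c + k)) (hD : D = .var (d + k))
    (hα : σ α = .var n) (hn : n ≠ g + k) (hσ : ∀ s, σ ⟨s, 1⟩ = .ali ⟨s, 1⟩) :
    Wit ⟨k, σ, twoSessions (verifier C D ke km) (proverWait C D ke km (.var n))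
        (verifier C D ke km) W B R⟩
      (.diaIn (.var d) (.ali α) <| .diaIn (.var d) (.ali α) <|
        .diaOut (.var c) <| .diaOut (.var (c + 1)) <|
        .and (.neg (.eq (.ali α) (.var (g + 2)))) <|
        .and (.neg (.eq (.var 1) (.var (g + 2)))) <|
        .and (.neg (.eq (.var 0) (.var (g + 2)))) <|
        .and
          (.diaIn (.var (d + 2)) (.var 1) <| .diaOut (.var (c + 2)) <|
            .neg (.eq (.var 0) (.var (g + 3))))
          (.diaIn (.var (d + 2)) (.var 0) <| .diaOut (.var (c + 2)) <|
            .neg (.eq (.var 0) (.var (g + 3))))) := by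
  have hf : (Msg.var d).fal ∪ (Msg.ali α).fal ⊆ σ.dom := by
    simpa [Msg.fal] using mem_dom_of_eq_var hα
  have hσ₀ : σ.shift 0 = σ := funext fun α => Msg.shift_zero _
  refine .diaIn (Step.of_inp (.parL (.parL (.parL (.verifier ?_)))) hf) ?_
  · simp [hD]
  simp only [Term.shift_eq_subst, Term.subst, proverWait_subst, verifier_subst,
    Msg.subst_eq_shift, Msg.shift_zero, hσ₀, Msg.shift_ali, Msg.asubst_ali, hα, Nat.zero_add]
  refine .diaIn (Step.of_inp (.parL (.parR (.parL (.parL (.verifier ?_))))) hf) ?_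
  · simp [hD]
  simp only [Term.shift_eq_subst, Term.subst, proverWait_subst, verifierReply_subst,
    Msg.subst_eq_shift, Msg.shift_zero, hσ₀, Msg.shift_ali, Msg.asubst_ali, hα, Nat.zero_add]
  exact wit_replies hC hD hα hn hσ

theorem wit_system (c d g : ℕ) :
    Wit (.ofProc (systemGet c d g)) (attackFormula c d g) := by
  -- Both replications are unfolded once. The passport then sits at location `001` and the reader of
  -- its session at `000`.
  refine .diaIn (Step.of_inp (k := 0)
    (.bang (.parL (.ext (.ext (.bang (.parL (.parR (.proverStart ?_)))))))) ?_) ?_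
  · exact .refl _
  · simp [Msg.fal]
  refine .diaOut (Step.of_out (s := [false, false, false]) (t := []) (l := 0)
    (.parL (.parL (.parL (.out 0 ?_)))) ?_ ?_) ?_ ?_ ?_
  · simp
  · simp [Msg.fal]
  · simp [ASubst.dom, ASubst.shift, ASubst.one]
  · simp [Formula.fal, Formula.ne, Msg.fal]
  · simp [ExtProc.dom, ASubst.dom]
  simp only [Formula.inst, Formula.subst, Formula.ne, Msg.subst_var, up_zero, up_succ,
    scons_succ, scons_zero, Msg.shift_var, Msg.shift_ali, Term.shift_eq_subst, Term.subst,
    session_subst, prover_subst, Msg.subst_eq_shift]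
  -- The inner replication is unfolded again below the same key binders, so the reader at `0100`
  -- shares the passport's keys. This is the step that the specification cannot match.
  refine .diaOut (Step.of_out (s := [false, true, false, false]) (t := []) (l := 0)
    (.parL (.parR (.bang (.parL (.parL (.out 0 ?_)))))) ?_ ?_) ?_ ?_ ?_
  · simp
  · simp [Msg.fal]
  · simp [ASubst.dom, ASubst.shift, ASubst.one]
  · simp [Formula.fal, Msg.fal]
  · simp [ExtProc.dom, ASubst.dom]
  simp only [Formula.inst, Formula.subst, Msg.subst_var, up_zero, up_succ,
    scons_succ, scons_zero, Msg.shift_var, Msg.subst_ali, Term.shift_eq_subst, Term.subst,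
    session_subst, prover_subst, Msg.subst_eq_shift, verifier_subst]
  refine .and (.eq ?_) (.and (.eq ?_) ?_)
  · simp [ExtProc.Test, ASubst.shift]
  · simp [ExtProc.Test]
  refine .diaOut (Step.of_out (s := [false, false, true]) (t := []) (l := 0)
    (.parL (.parL (.parR (.mat (.prover ?_ 0) ?_)))) ?_ ?_) ?_ ?_ ?_
  · simp
  · simp
  · simp [Msg.fal]
  · simp [ASubst.dom, ASubst.shift, ASubst.one]
  · simp [Formula.fal, Msg.fal]
  · simp [ExtProc.dom, ASubst.dom]
  simp only [Formula.inst, Formula.subst, Msg.subst_var, up_zero, up_succ,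
    scons_succ, scons_zero, Msg.shift_var, Msg.shift_ali, Term.shift_eq_subst, Term.subst,
    verifier_subst]
  refine wit_nonce ?_ ?_ ?_ ?_ ?_
  · simp
  · simp
  · simp
  · simp
  · simp [ASubst.shift, ASubst.one]

/-! ## Simulations preserve the simulation fragment -/

/-- Replace the aliases of a formula. -/
def Formula.amap (ρ : Alias → Alias) : Formula → Formula
  | tru => tru
  | eq M N => eq (M.asubst (aren ρ)) (N.asubst (aren ρ))
  | and φ ψ => and (φ.amap ρ) (ψ.amap ρ)
  | neg φ => neg (φ.amap ρ)
  | diaTau φ => diaTau (φ.amap ρ)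
  | diaIn M N φ => diaIn (M.asubst (aren ρ)) (N.asubst (aren ρ)) (φ.amap ρ)
  | diaOut M φ => diaOut (M.asubst (aren ρ)) (φ.amap ρ)

@[simp] theorem Msg.asubst_aren_id (M : Msg) : M.asubst (aren id) = M := Msg.bind_var_ali M

@[simp] theorem Formula.amap_id (φ : Formula) : φ.amap id = φ := by
  induction φ <;> simp_all [Formula.amap]

theorem Msg.fal_asubst_aren (ρ : Alias → Alias) (M : Msg) :
    (M.asubst (aren ρ)).fal = ρ '' M.fal := by
  unfold Msg.asubst
  induction M <;> simp_all [Msg.bind, Msg.fal, aren, Set.image_union]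

theorem Formula.fal_amap (ρ : Alias → Alias) (φ : Formula) : (φ.amap ρ).fal = ρ '' φ.fal := by
  induction φ <;> simp_all [Formula.amap, Formula.fal, Msg.fal_asubst_aren, Set.image_union]

theorem Msg.fal_subst_subset {s : ℕ → Msg} {S : Set Alias} (hs : ∀ x, (s x).fal ⊆ S) (M : Msg) :
    (M.subst s).fal ⊆ M.fal ∪ S := by
  unfold Msg.subst
  induction M with
  | var x => exact (hs x).trans Set.subset_union_right
  | ali α => exact Set.subset_union_left
  | fst M h => exact h
  | snd M h => exact h
  | _ =>
    simp only [Msg.bind, Msg.fal]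
    grind

theorem Formula.fal_subst_subset {S : Set Alias} (φ : Formula) :
    ∀ {s : ℕ → Msg}, (∀ x, (s x).fal ⊆ S) → (φ.subst s).fal ⊆ φ.fal ∪ S := by
  induction φ with
  | tru => intro s hs; simp [Formula.subst, Formula.fal]
  | eq M N =>
    intro s hs
    have h₁ := Msg.fal_subst_subset hs M
    have h₂ := Msg.fal_subst_subset hs N
    simp only [Formula.subst, Formula.fal]
    grind
  | and φ ψ h₁ h₂ =>
    intro s hs
    have h₁ := h₁ hs
    have h₂ := h₂ hs
    simp only [Formula.subst, Formula.fal]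
    grind
  | neg φ h => intro s hs; exact h hs
  | diaTau φ h => intro s hs; exact h hs
  | diaIn M N φ h =>
    intro s hs
    have h₁ := Msg.fal_subst_subset hs M
    have h₂ := Msg.fal_subst_subset hs N
    have h₃ := h hs
    simp only [Formula.subst, Formula.fal]
    grind
  | diaOut M φ h =>
    intro s hs
    have h₁ := Msg.fal_subst_subset hs M
    have h₂ := @h (up s) (fun x => by cases x <;> simp [Msg.fal, hs])
    simp only [Formula.subst, Formula.fal]
    grind

theorem Formula.fal_inst_subset (φ : Formula) (α : Alias) :
    (φ.inst (.ali α)).fal ⊆ φ.fal ∪ {α} :=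
  φ.fal_subst_subset (fun x => by cases x <;> simp [Msg.fal])

theorem Msg.bind_congr {s : ℕ → Msg} {σ τ : Alias → Msg} {M : Msg}
    (h : ∀ α ∈ M.fal, σ α = τ α) : M.bind s σ = M.bind s τ := by
  induction M <;> simp_all [Msg.bind, Msg.fal]

/-- The two renamings need to agree only on aliases already in `M`, as those that `s` introduces are
handled by `hs`. This freedom allows `ρ` to be updated at a fresh alias. -/
theorem Msg.asubst_subst {s s' : ℕ → Msg} {ρ ρ' : Alias → Alias} {M : Msg}
    (hs : ∀ x, (s x).asubst (aren ρ) = s' x) (hρ : ∀ α ∈ M.fal, ρ α = ρ' α) :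
    (M.subst s).asubst (aren ρ) = (M.asubst (aren ρ')).subst s' := by
  have h₁ : (fun x => (s x).bind var (aren ρ)) = s' := funext hs
  rw [Msg.asubst, Msg.subst, Msg.subst, Msg.asubst, Msg.bind_bind, Msg.bind_bind, h₁]
  exact Msg.bind_congr fun α hα => by simp [Msg.bind, aren, hρ α hα]

theorem Msg.asubst_shift (k : ℕ) (ρ : Alias → Alias) (M : Msg) :
    (M.shift k).asubst (aren ρ) = (M.asubst (aren ρ)).shift k :=
  Msg.asubst_subst (fun _ => rfl) (fun _ _ => rfl)

theorem Formula.amap_subst {ρ ρ' : Alias → Alias} (φ : Formula) :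
    ∀ {s s' : ℕ → Msg}, (∀ x, (s x).asubst (aren ρ) = s' x) → (∀ α ∈ φ.fal, ρ α = ρ' α) →
      (φ.subst s).amap ρ = (φ.amap ρ').subst s' := by
  induction φ with
  | tru => intros; rfl
  | eq M N =>
    intro s s' hs hρ
    exact congrArg₂ _ (Msg.asubst_subst hs fun α h => hρ α (.inl h))
      (Msg.asubst_subst hs fun α h => hρ α (.inr h))
  | and φ ψ h₁ h₂ =>
    intro s s' hs hρ
    exact congrArg₂ _ (h₁ hs fun α h => hρ α (.inl h)) (h₂ hs fun α h => hρ α (.inr h))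
  | neg φ h => intro s s' hs hρ; exact congrArg _ (h hs hρ)
  | diaTau φ h => intro s s' hs hρ; exact congrArg _ (h hs hρ)
  | diaIn M N φ h =>
    intro s s' hs hρ
    simp only [Formula.subst, Formula.amap]
    rw [Msg.asubst_subst hs fun α h => hρ α (.inl (.inl h)),
      Msg.asubst_subst hs fun α h => hρ α (.inl (.inr h)), h hs fun α h => hρ α (.inr h)]
  | diaOut M φ h =>
    intro s s' hs hρ
    refine congrArg₂ _ (Msg.asubst_subst hs fun α h => hρ α (.inl h))
      (h (fun x => ?_) fun α h => hρ α (.inr h))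
    cases x with
    | zero => rfl
    | succ x => simp [Msg.asubst_shift, hs]

/-- Matches the update of the bijection in the output clause of a simulation with the instantiation
in the output modality. -/
theorem Formula.amap_update_inst {ρ : Alias → Alias} {φ : Formula} {α α' : Alias}
    (h : α ∉ φ.fal) :
    (φ.inst (.ali α)).amap (Function.update ρ α α') = (φ.amap ρ).inst (.ali α') := by
  refine φ.amap_subst (fun x => ?_) fun β hβ => ?_
  · cases x <;> simp [aren]
  · exact Function.update_of_ne (ne_of_mem_of_not_mem hβ h) _ _

theorem Msg.eq_ali_of_shift {k : ℕ} {M : Msg} {α : Alias} (h : M.shift k = ali α) :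
    M = ali α := by
  cases M <;> simp_all [Msg.shift_eq_bind, Msg.bind]

theorem ASubst.dom_subset_shift (k : ℕ) (σ : ASubst) : σ.dom ⊆ (σ.shift k).dom :=
  fun _ h h' => h (Msg.eq_ali_of_shift h')

/-- Shifting never turns another message into an alias, so existing entries stay in the domain. -/
theorem Step.dom_subset {A B : ExtProc} {π : Act} {u : LocLabel} (h : Step A π u B)
    (hα : ∀ M α, π = .out M α → α ∈ B.dom) : A.dom ⊆ B.dom := by
  induction h with
  | @res _ _ _ _ _ _ π _ _ ih =>
    refine ih fun M α h => ?_
    obtain ⟨M, rfl, -⟩ := Act.shift_out_inv h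
    exact hα M α rfl
  | @aliasOut k σ P Q M N l s t h h₁ h₂ =>
    intro β hβ
    by_cases e : β = ⟨s, l⟩
    · exact e ▸ hα _ _ rfl
    · have := ASubst.dom_subset_shift k σ hβ
      simpa [ExtProc.dom, ASubst.dom, e] using this
  | aliasFree => exact ASubst.dom_subset_shift _ _

/-- Keeping the aliases of the formula inside `A.dom` is what makes the static clause applicable at
every equality. The condition `α ∈ B.dom` in `Wit` maintains this invariant through outputs. -/
theorem Wit.sat_of_simulation {R : (Alias → Alias) → ExtProc → ExtProc → Prop}
    (hR : IsISimulation R) {A : ExtProc} {φ : Formula} (h : Wit A φ) :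
    ∀ {ρ : Alias → Alias} {B : ExtProc}, R ρ A B → φ.fal ⊆ A.dom → Sat B (φ.amap ρ) := by
  induction h with
  | tru => intros; simp [Sat, Formula.amap]
  | eq h =>
    intro ρ B hAB hf
    have := (hR _ _ _ hAB).2.2.2 _ _ (Set.subset_union_left.trans hf)
      (Set.subset_union_right.trans hf)
    simpa [Sat, Formula.amap] using this.1 h
  | ne h =>
    intro ρ B hAB hf
    have := (hR _ _ _ hAB).2.2.2 _ _ (Set.subset_union_left.trans hf)
      (Set.subset_union_right.trans hf)
    simpa [Sat, Formula.amap] using mt this.2 h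
  | and _ _ h₁ h₂ =>
    intro ρ B hAB hf
    rw [Formula.amap, Sat]
    exact ⟨h₁ hAB (Set.subset_union_left.trans hf), h₂ hAB (Set.subset_union_right.trans hf)⟩
  | diaTau h _ ih =>
    intro ρ B hAB hf
    obtain ⟨u, B', hB, hAB'⟩ := (hR _ _ _ hAB).2.1 _ _ _ (by simp [Act.IsOut]) h
    rw [Formula.amap, Sat]
    exact ⟨u, B', hB, ih hAB' (hf.trans (h.dom_subset (by simp)))⟩
  | diaIn h _ ih =>
    intro ρ B hAB hf
    obtain ⟨u, B', hB, hAB'⟩ := (hR _ _ _ hAB).2.1 _ _ _ (by simp [Act.IsOut]) h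
    rw [Formula.amap, Sat]
    exact ⟨u, B', hB,
      ih hAB' ((Set.subset_union_right.trans hf).trans (h.dom_subset (by simp)))⟩
  | @diaOut A A' u M α φ h h₁ h₂ _ ih =>
    intro ρ B hAB hf
    obtain ⟨hρ, -, hout, -⟩ := hR _ _ _ hAB
    obtain ⟨α', u', B', hB, hAB'⟩ := hout _ _ _ _ h
    have hφ : φ.fal ⊆ A.dom := Set.subset_union_right.trans hf
    rw [Formula.amap, Sat]
    refine ⟨α', u', B', hB, ?_, ?_⟩
    -- The alias chosen by `B` lies outside `B.dom`, while `ρ` sends the aliases of `φ` into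
    -- `B.dom`; so it is fresh for the renamed formula.
    · obtain ⟨-, -, -, -, hα', -⟩ := hB.out_inv
      rw [Formula.fal_amap]
      rintro ⟨β, hβ, rfl⟩
      exact hα' (hρ.mapsTo (hφ hβ))
    · rw [← Formula.amap_update_inst h₁]
      refine ih hAB' ((φ.fal_inst_subset α).trans (Set.union_subset (hφ.trans ?_) (by simpa)))
      refine h.dom_subset fun M' β e => ?_
      cases e
      exact h₂

end AppliedPi

theorem mainTheorem8 (c d g : ℕ) (hcd : c ≠ d) (hcg : c ≠ g) (hdg : d ≠ g) :
    (AppliedPi.attackFormula c d g).InSimulationFragment ∧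
    AppliedPi.Sat (.ofProc (AppliedPi.systemGet c d g)) (AppliedPi.attackFormula c d g) ∧
    ¬ AppliedPi.Sat (.ofProc (AppliedPi.specGet c d g)) (AppliedPi.attackFormula c d g) ∧
    ¬ AppliedPi.ISimulatedBy
        (.ofProc (AppliedPi.systemGet c d g)) (.ofProc (AppliedPi.specGet c d g)) := by
  have hw := AppliedPi.wit_system c d g
  refine ⟨by simp [AppliedPi.attackFormula, AppliedPi.Formula.InSimulationFragment,
    AppliedPi.Formula.ne], hw.sat, AppliedPi.not_sat_spec c d g, ?_⟩
  rintro ⟨R, hR, h⟩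
  refine AppliedPi.not_sat_spec c d g ?_
  -- The attack formula contains no alias, so the domain condition is trivial, and the initial
  -- bijection `id` leaves the formula unchanged.
  have := hw.sat_of_simulation hR h
    (by simp [AppliedPi.attackFormula, AppliedPi.Formula.fal, AppliedPi.Formula.ne,
      AppliedPi.Msg.fal])
  rwa [AppliedPi.Formula.amap_id] at this
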